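/- Let $K$ be a field and let $E$ and $F$ be finite directed graphs (finitely many vertices and edges) with no sinks, i.e. every vertex emits at least one edge. Let $A_E$ and $A_F$ be their adjacency matrices, where the $(v,w)$ entry is the number of edges from $v$ to $w$. Let $\mathcal L_K(E)$ be the Leavitt path algebra of $E$: the $K$-algebra generated by the vertices $v$, the edges $\alpha$ and the ghost edges $\alpha^*$, subject to $vw=\delta_{v,w}v$ for vertices $v,w$; $s(\alpha)\alpha=\alpha r(\alpha)=\alpha$ and $r(\alpha)\alpha^*=\alpha^*s(\alpha)=\alpha^*$; $\alpha^*\beta=\delta_{\alpha,\beta}\,r(\alpha)$ for edges $\alpha,\beta$; and $\sum_{s(\alpha)=v}\alpha\alpha^*=v$ for every vertex $v$ that emits an edge. Its identity is $\sum_v v$, and it is $\mathbb Z$-graded by $\deg v=0$, $\deg\alpha=1$, $\deg\alpha^*=-1$. For a $\mathbb Z$-graded ring $A$ let $K_0^{\mathrm{gr}}(A)$ be the group completion of the monoid $\mathcal V^{\mathrm{gr}}(A)$ of graded isomorphism classes of $\mathbb Z$-graded finitely generated projective right $A$-modules under direct sum. It is a $\mathbb Z[x,x^{-1}]$-module via $x^k[P]=[P(k)]$,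 where $P(k)_i=P_{k+i}$, and it is pre-ordered with positive cone the image of $\mathcal V^{\mathrm{gr}}(A)$. Two square nonnegative integer matrices $A$ and $B$ are shift equivalent if there are an integer $l\ge 1$ and nonnegative integer matrices $R$ and $S$ with $A^l=RS$, $B^l=SR$, $AR=RB$ and $SA=BS$. Then $A_E$ and $A_F$ are shift equivalent if and only if there is a $\mathbb Z[x,x^{-1}]$-module isomorphism $\varphi: K_0^{\mathrm{gr}}(\mathcal L_K(E))\to K_0^{\mathrm{gr}}(\mathcal L_K(F))$ that is an isomorphism of pre-ordered groups, i.e. $\varphi(a)\le\varphi(b)$ if and only if $a\le b$ for all $a,b$ (equivalently, $\varphi$ maps the positive cone onto the positive cone). -/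

import Mathlib

open scoped DirectSum LaurentPolynomial
open MulOpposite (op)

universe u v w

/-! ### Shift equivalence of nonnegative integer matrices -/

/-- Two square nonnegative integer matrices `A` and `B` are shift equivalent if for some `l ≥ 1`
there are nonnegative integer matrices `R`, `S` with `A ^ l = R S`, `B ^ l = S R`, `A R = R B`
and `S A = B S`. -/
def Matrix.ShiftEquivalent {m : Type*} {n : Type*} [Fintype m] [DecidableEq m] [Fintype n]
    [DecidableEq n] (A : Matrix m m ℕ) (B : Matrix n n ℕ) : Prop :=
  ∃ (l : ℕ) (R : Matrix m n ℕ) (S : Matrix n m ℕ),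
    1 ≤ l ∧ A ^ l = R * S ∧ B ^ l = S * R ∧ A * R = R * B ∧ S * A = B * S

/-! ### Graded finitely generated projective modules and the graded Grothendieck group -/

section GradedK

variable {A : Type u} [Ring A] {σ : Type v} [SetLike σ A] (𝒜 : ℤ → σ)

/-- A `ℤ`-graded finitely generated projective right module over the ring `A` with graded
components `𝒜 i`. A right `A`-module is a module over `Aᵐᵒᵖ`. -/
structure GrProjModule where
  carrier : Type u
  [addCommGroup : AddCommGroup carrier]
  [module : Module Aᵐᵒᵖ carrier]
  component : ℤ → AddSubgroup carrier
  isInternal : DirectSum.IsInternal component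
  smul_mem : ∀ {i j : ℤ} {x : carrier} {a : A},
    x ∈ component i → a ∈ 𝒜 j → op a • x ∈ component (i + j)
  finite : Module.Finite Aᵐᵒᵖ carrier
  projective : Module.Projective Aᵐᵒᵖ carrier

namespace GrProjModule

attribute [instance] addCommGroup module finite projective

variable {𝒜}

/-- `P` and `Q` are graded isomorphic: there is a module isomorphism mapping each homogeneous
component of `P` into (equivalently, onto) the corresponding one of `Q`. -/
def GrIso (P Q : GrProjModule 𝒜) : Prop :=
  ∃ f : P.carrier ≃ₗ[Aᵐᵒᵖ] Q.carrier, ∀ (i : ℤ) (x : P.carrier),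
    f x ∈ Q.component i ↔ x ∈ P.component i

theorem isInternal_prod {M N : Type*} [AddCommGroup M] [AddCommGroup N]
    {p : ℤ → AddSubgroup M} {q : ℤ → AddSubgroup N} (hp : DirectSum.IsInternal p)
    (hq : DirectSum.IsInternal q) : DirectSum.IsInternal fun i => (p i).prod (q i) := by
  let fp : ∀ i, (p i).prod (q i) →+ p i := fun i =>
    ((AddMonoidHom.fst M N).comp ((p i).prod (q i)).subtype).codRestrict (p i) fun x => x.2.1
  let fq : ∀ i, (p i).prod (q i) →+ q i := fun i =>
    ((AddMonoidHom.snd M N).comp ((p i).prod (q i)).subtype).codRestrict (q i) fun x => x.2.2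
  let a : ∀ i, p i →+ (p i).prod (q i) := fun i =>
    ((AddMonoidHom.inl M N).comp (p i).subtype).codRestrict ((p i).prod (q i)) fun x =>
      ⟨x.2, (q i).zero_mem⟩
  let b : ∀ i, q i →+ (p i).prod (q i) := fun i =>
    ((AddMonoidHom.inr M N).comp (q i).subtype).codRestrict ((p i).prod (q i)) fun x =>
      ⟨(p i).zero_mem, x.2⟩
  let c := DirectSum.coeAddMonoidHom fun i => (p i).prod (q i)
  have ha : c.comp (DirectSum.map a) =
      (AddMonoidHom.inl M N).comp (DirectSum.coeAddMonoidHom p) := by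
    refine DirectSum.addHom_ext' fun i => AddMonoidHom.ext fun x => ?_
    simp only [c, AddMonoidHom.comp_apply, DirectSum.map_of, DirectSum.coeAddMonoidHom_of]
    rfl
  have hb : c.comp (DirectSum.map b) =
      (AddMonoidHom.inr M N).comp (DirectSum.coeAddMonoidHom q) := by
    refine DirectSum.addHom_ext' fun i => AddMonoidHom.ext fun x => ?_
    simp only [c, AddMonoidHom.comp_apply, DirectSum.map_of, DirectSum.coeAddMonoidHom_of]
    rfl
  have hfp : (AddMonoidHom.fst M N).comp c =
      (DirectSum.coeAddMonoidHom p).comp (DirectSum.map fp) := by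
    refine DirectSum.addHom_ext' fun i => AddMonoidHom.ext fun x => ?_
    simp only [c, AddMonoidHom.comp_apply, DirectSum.map_of, DirectSum.coeAddMonoidHom_of]
    rfl
  have hfq : (AddMonoidHom.snd M N).comp c =
      (DirectSum.coeAddMonoidHom q).comp (DirectSum.map fq) := by
    refine DirectSum.addHom_ext' fun i => AddMonoidHom.ext fun x => ?_
    simp only [c, AddMonoidHom.comp_apply, DirectSum.map_of, DirectSum.coeAddMonoidHom_of]
    rfl
  constructor
  · intro x y hxy
    have h1 : DirectSum.map fp x = DirectSum.map fp y := hp.1 <| by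
      have := congrArg Prod.fst (show c x = c y from hxy)
      exact (DFunLike.congr_fun hfp x).symm.trans (this.trans (DFunLike.congr_fun hfp y))
    have h2 : DirectSum.map fq x = DirectSum.map fq y := hq.1 <| by
      have := congrArg Prod.snd (show c x = c y from hxy)
      exact (DFunLike.congr_fun hfq x).symm.trans (this.trans (DFunLike.congr_fun hfq y))
    refine DFinsupp.ext fun i => Subtype.ext (Prod.ext ?_ ?_)
    · have := congrArg (fun z => ((z i : p i) : M)) h1
      simp only [DirectSum.map_apply] at this
      exact this
    · have := congrArg (fun z => ((z i : q i) : N)) h2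
      simp only [DirectSum.map_apply] at this
      exact this
  · rintro ⟨x, y⟩
    obtain ⟨x, rfl⟩ := hp.2 x
    obtain ⟨y, rfl⟩ := hq.2 y
    refine ⟨DirectSum.map a x + DirectSum.map b y, ?_⟩
    rw [map_add]
    refine (congrArg₂ (· + ·) (DFunLike.congr_fun ha x) (DFunLike.congr_fun hb y)).trans ?_
    exact Prod.ext (add_zero _) (zero_add _)

theorem isInternal_shift {M : Type*} [AddCommGroup M] {p : ℤ → AddSubgroup M}
    (hp : DirectSum.IsInternal p) (k : ℤ) : DirectSum.IsInternal fun i => p (k + i) := by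
  let e : (⨁ i, p i) ≃+ ⨁ i, p (k + i) :=
    DirectSum.equivCongrLeft (β := fun i => p i) (Equiv.addLeft k).symm
  have h : (DirectSum.coeAddMonoidHom fun i => p (k + i)).comp e.toAddMonoidHom =
      DirectSum.coeAddMonoidHom p := by
    refine DirectSum.addHom_ext' fun i => AddMonoidHom.ext fun x => ?_
    obtain ⟨j, rfl⟩ : ∃ j, i = k + j := ⟨-k + i, by ring⟩
    have he : e (DirectSum.of (fun i => p i) (k + j) x) =
        DirectSum.of (fun i => p (k + i)) j x := by
      refine DFinsupp.ext fun n => ?_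
      refine (DirectSum.equivCongrLeft_apply _ _ _).trans ?_
      by_cases hn : j = n
      · subst hn
        exact (DirectSum.of_eq_same (β := fun i => p i) (k + j) x).trans
          (DirectSum.of_eq_same (β := fun i => p (k + i)) j x).symm
      · have hn' : k + n ≠ k + j := fun h => hn (add_left_cancel h).symm
        exact (DirectSum.of_eq_of_ne (β := fun i => p i) (k + j) (k + n) x hn').trans
          (DirectSum.of_eq_of_ne (β := fun i => p (k + i)) j n x (Ne.symm hn)).symm
    simp only [AddMonoidHom.comp_apply, DirectSum.coeAddMonoidHom_of]
    refine (congrArg _ he).trans ?_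
    exact DirectSum.coeAddMonoidHom_of _ _ _
  have h' : Function.Bijective
      ((DirectSum.coeAddMonoidHom fun i => p (k + i)) ∘ e) := by
    have : (DirectSum.coeAddMonoidHom fun i => p (k + i)) ∘ e = DirectSum.coeAddMonoidHom p :=
      congrArg DFunLike.coe h
    rw [this]
    exact hp
  exact (Function.Bijective.of_comp_iff _ e.bijective).1 h'

/-- The direct sum `P ⊕ Q` of graded modules. -/
def prod (P Q : GrProjModule 𝒜) : GrProjModule 𝒜 where
  carrier := P.carrier × Q.carrier
  component i := (P.component i).prod (Q.component i)
  isInternal := isInternal_prod P.isInternal Q.isInternal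
  smul_mem hx ha := ⟨P.smul_mem hx.1 ha, Q.smul_mem hx.2 ha⟩
  finite := inferInstance
  projective := inferInstance

/-- The zero graded module. -/
def zero : GrProjModule 𝒜 where
  carrier := PUnit
  component _ := ⊤
  isInternal := by
    refine ⟨fun x y _ => DFinsupp.ext fun i => Subtype.ext rfl, fun y => ⟨?_, rfl⟩⟩
    exact DirectSum.of _ 0 0
  smul_mem _ _ := trivial
  finite := inferInstance
  projective := inferInstance

/-- The shifted (suspended) module `P(k)`, with `P(k)_i = P_{k + i}`. -/
def shift (k : ℤ) (P : GrProjModule 𝒜) : GrProjModule 𝒜 where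
  carrier := P.carrier
  component i := P.component (k + i)
  isInternal := isInternal_shift P.isInternal k
  smul_mem hx ha := add_assoc k _ _ ▸ P.smul_mem hx ha
  finite := P.finite
  projective := P.projective

variable (𝒜) in
/-- Graded isomorphism as an equivalence relation. -/
instance setoid : Setoid (GrProjModule 𝒜) where
  r := GrIso
  iseqv :=
    { refl := fun _ => ⟨LinearEquiv.refl _ _, fun _ _ => Iff.rfl⟩
      symm := fun ⟨f, hf⟩ => ⟨f.symm, fun i x => by simpa using (hf i (f.symm x)).symm⟩
      trans := fun ⟨f, hf⟩ ⟨g, hg⟩ => ⟨f.trans g, fun i x => (hg i (f x)).trans (hf i x)⟩ }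

end GrProjModule

/-- The monoid `V^gr(A)` of graded isomorphism classes of graded finitely generated projective
right `A`-modules. -/
def Vgr : Type (u + 1) := Quotient (GrProjModule.setoid 𝒜)

namespace Vgr

variable {𝒜}

/-- The class `[P]`. -/
def mk (P : GrProjModule 𝒜) : Vgr 𝒜 := Quotient.mk _ P

instance : Zero (Vgr 𝒜) := ⟨mk GrProjModule.zero⟩

/-- Addition is given by direct sum: `[P] + [Q] = [P ⊕ Q]`. -/
instance : Add (Vgr 𝒜) where
  add := Quotient.map₂ GrProjModule.prod fun _ _ ⟨f, hf⟩ _ _ ⟨g, hg⟩ =>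
    ⟨f.prodCongr g, fun i x => and_congr (hf i x.1) (hg i x.2)⟩

instance : AddCommMonoid (Vgr 𝒜) where
  nsmul := nsmulRec
  add_assoc := by
    rintro ⟨P⟩ ⟨Q⟩ ⟨R⟩
    exact Quotient.sound ⟨LinearEquiv.prodAssoc Aᵐᵒᵖ P.carrier Q.carrier R.carrier,
      fun _ _ => and_assoc.symm⟩
  zero_add := by
    rintro ⟨P⟩
    exact Quotient.sound ⟨LinearEquiv.uniqueProd (R := Aᵐᵒᵖ) (M := P.carrier) (M₂ := PUnit.{u + 1}),
      fun _ _ => ⟨fun h => ⟨trivial, h⟩, fun h => h.2⟩⟩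
  add_zero := by
    rintro ⟨P⟩
    exact Quotient.sound ⟨LinearEquiv.prodUnique (R := Aᵐᵒᵖ) (M := P.carrier) (M₂ := PUnit.{u + 1}),
      fun _ _ => ⟨fun h => ⟨h, trivial⟩, fun h => h.1⟩⟩
  add_comm := by
    rintro ⟨P⟩ ⟨Q⟩
    exact Quotient.sound ⟨LinearEquiv.prodComm Aᵐᵒᵖ P.carrier Q.carrier, fun _ _ => and_comm⟩

/-- The shift `[P] ↦ [P(k)]`. -/
def shift (k : ℤ) : Vgr 𝒜 →+ Vgr 𝒜 where
  toFun := Quotient.map (GrProjModule.shift k) fun _ _ ⟨f, hf⟩ => ⟨f, fun i => hf (k + i)⟩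
  map_zero' := rfl
  map_add' := by
    rintro ⟨P⟩ ⟨Q⟩
    rfl

theorem shift_zero : shift 0 = AddMonoidHom.id (Vgr 𝒜) := by
  ext x
  obtain ⟨P⟩ := x
  refine Quotient.sound ⟨LinearEquiv.refl _ _, fun i x => ?_⟩
  change x ∈ P.component i ↔ x ∈ P.component (0 + i)
  rw [zero_add]

theorem shift_add (k l : ℤ) : shift (k + l) = (shift k).comp (shift (𝒜 := 𝒜) l) := by
  ext x
  obtain ⟨P⟩ := x
  refine Quotient.sound ⟨LinearEquiv.refl _ _, fun i x => ?_⟩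
  change x ∈ P.component (l + (k + i)) ↔ x ∈ P.component (k + l + i)
  rw [show l + (k + i) = k + l + i by ring]

end Vgr

/-- The graded Grothendieck group `K₀^gr(A)`: the group completion of `V^gr(A)`. -/
def K0gr : Type (u + 1) := Algebra.GrothendieckAddGroup (Vgr 𝒜)

namespace K0gr

instance : AddCommGroup (K0gr 𝒜) :=
  inferInstanceAs (AddCommGroup (Algebra.GrothendieckAddGroup (Vgr 𝒜)))

/-- The natural homomorphism `V^gr(A) → K₀^gr(A)`. -/
def of : Vgr 𝒜 →+ K0gr 𝒜 := Algebra.GrothendieckAddGroup.of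

variable {𝒜} in
theorem hom_ext {f g : K0gr 𝒜 →+ K0gr 𝒜} (h : f.comp (of 𝒜) = g.comp (of 𝒜)) : f = g :=
  Algebra.GrothendieckAddGroup.lift.symm.injective h

/-- The map `[P] ↦ [P(k)]` on `K₀^gr(A)`. -/
noncomputable def shift (k : ℤ) : K0gr 𝒜 →+ K0gr 𝒜 :=
  Algebra.GrothendieckAddGroup.lift (G := K0gr 𝒜) ((of 𝒜).comp (Vgr.shift k))

theorem shift_comp_of (k : ℤ) : (shift 𝒜 k).comp (of 𝒜) = (of 𝒜).comp (Vgr.shift k) :=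
  (Algebra.GrothendieckAddGroup.lift (G := K0gr 𝒜)).symm_apply_apply ((of 𝒜).comp (Vgr.shift k))

theorem shift_of (k : ℤ) (x : Vgr 𝒜) : shift 𝒜 k (of 𝒜 x) = of 𝒜 (Vgr.shift k x) :=
  DFunLike.congr_fun (shift_comp_of 𝒜 k) x

/-- The action of the group `ℤ` on `K₀^gr(A)` by shifts. -/
noncomputable def shiftHom : Multiplicative ℤ →* AddMonoid.End (K0gr 𝒜) where
  toFun k := shift 𝒜 k.toAdd
  map_one' := hom_ext <| AddMonoidHom.ext fun x => by
    change shift 𝒜 0 (of 𝒜 x) = of 𝒜 x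
    rw [shift_of, Vgr.shift_zero, AddMonoidHom.id_apply]
  map_mul' k l := hom_ext <| AddMonoidHom.ext fun x => by
    change shift 𝒜 (k.toAdd + l.toAdd) (of 𝒜 x) = shift 𝒜 k.toAdd (shift 𝒜 l.toAdd (of 𝒜 x))
    rw [shift_of, shift_of, shift_of, Vgr.shift_add, AddMonoidHom.comp_apply]

/-- The `ℤ[x, x⁻¹]`-module structure on `K₀^gr(A)`, with `x ^ k [P] = [P(k)]`. -/
noncomputable instance : Module ℤ[T;T⁻¹] (K0gr 𝒜) :=
  Module.compHom (K0gr 𝒜)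
    (AddMonoidAlgebra.lift ℤ (AddMonoid.End (K0gr 𝒜)) ℤ (shiftHom 𝒜)).toRingHom

theorem T_smul_of_mk (k : ℤ) (P : GrProjModule 𝒜) :
    (LaurentPolynomial.T k : ℤ[T;T⁻¹]) • of 𝒜 (Vgr.mk P) = of 𝒜 (Vgr.mk (P.shift k)) := by
  have h : AddMonoidAlgebra.lift ℤ (AddMonoid.End (K0gr 𝒜)) ℤ (shiftHom 𝒜)
      (LaurentPolynomial.T k) = shift 𝒜 k :=
    (AddMonoidAlgebra.lift_single _ _ _).trans (one_smul _ _)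
  exact (DFunLike.congr_fun h _).trans (shift_of 𝒜 k _)

/-- The pre-order on `K₀^gr(A)` whose positive cone is the image of `V^gr(A)`. -/
instance : Preorder (K0gr 𝒜) where
  le x y := y - x ∈ AddMonoidHom.mrange (of 𝒜)
  le_refl x := by simp
  le_trans x y z h₁ h₂ := by simpa using add_mem h₂ h₁

end K0gr

end GradedK

/-! ### Directed graphs and Leavitt path algebras -/

/-- A directed graph with vertex set `V`, edge set `E`, source map `s` and range map `r`. -/
structure DirectedGraph (V : Type u) (E : Type v) where
  s : E → V
  r : E → V

namespace DirectedGraph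

variable {V : Type u} {E : Type v} (G : DirectedGraph V E)

/-- No vertex is a sink: every vertex emits at least one edge. -/
def NoSinks : Prop := ∀ v : V, ∃ e : E, G.s e = v

/-- The adjacency matrix: its `(v, w)` entry is the number of edges from `v` to `w`. -/
def adjMatrix [Fintype E] [DecidableEq V] : Matrix V V ℕ :=
  fun v w => (Finset.univ.filter fun e => G.s e = v ∧ G.r e = w).card

/-- The generators of the Leavitt path algebra: vertices, edges and ghost edges. -/
inductive Gen (V : Type u) (E : Type v) : Type (max u v)
  | vertex (v : V)
  | edge (e : E)
  | ghost (e : E)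

/-- Vertices have degree `0`, edges have degree `1`, ghost edges have degree `-1`. -/
def Gen.deg : Gen V E → ℤ
  | .vertex _ => 0
  | .edge _ => 1
  | .ghost _ => -1

variable (K : Type w) [Field K]

section Rel

open FreeAlgebra (ι)
open Gen

/-- The defining relations of the Leavitt path algebra of a finite graph. The free algebra on the
generators is unital here, so the relation `one` is needed to make its identity agree with the
identity `∑ v` of the algebra generated by vertices, edges and ghost edges. -/
inductive LeavittRel [Fintype V] [Fintype E] [DecidableEq V] :
    FreeAlgebra K (Gen V E) → FreeAlgebra K (Gen V E) → Prop
  | one : LeavittRel (∑ v : V, ι K (vertex v)) 1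
  | vertex_idem (v : V) : LeavittRel (ι K (vertex v) * ι K (vertex v)) (ι K (vertex v))
  | vertex_orthogonal (v w : V) (h : v ≠ w) : LeavittRel (ι K (vertex v) * ι K (vertex w)) 0
  | s_edge (e : E) : LeavittRel (ι K (vertex (G.s e)) * ι K (edge e)) (ι K (edge e))
  | edge_r (e : E) : LeavittRel (ι K (edge e) * ι K (vertex (G.r e))) (ι K (edge e))
  | r_ghost (e : E) : LeavittRel (ι K (vertex (G.r e)) * ι K (ghost e)) (ι K (ghost e))
  | ghost_s (e : E) : LeavittRel (ι K (ghost e) * ι K (vertex (G.s e))) (ι K (ghost e))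
  | ghost_edge (e : E) : LeavittRel (ι K (ghost e) * ι K (edge e)) (ι K (vertex (G.r e)))
  | ghost_edge_ne (e f : E) (h : e ≠ f) : LeavittRel (ι K (ghost e) * ι K (edge f)) 0
  | sum_edge_ghost (v : V) (h : ∃ e, G.s e = v) :
      LeavittRel (∑ e : E with G.s e = v, ι K (edge e) * ι K (ghost e)) (ι K (vertex v))

end Rel

variable [Fintype V] [Fintype E] [DecidableEq V]

/-- The Leavitt path algebra `L_K(G)` of a finite graph. -/
abbrev LeavittPathAlgebra : Type (max u v w) := RingQuot (G.LeavittRel K)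

/-- The image of a generator in the Leavitt path algebra. -/
noncomputable def gen (x : Gen V E) : G.LeavittPathAlgebra K :=
  RingQuot.mkAlgHom K (G.LeavittRel K) (FreeAlgebra.ι K x)

/-- The homogeneous elements of degree `k`: linear combinations of words in the generators whose
degrees add up to `k`. -/
def leavittGrading (k : ℤ) : Submodule K (G.LeavittPathAlgebra K) :=
  Submodule.span K {a | ∃ l : List (Gen V E), (l.map Gen.deg).sum = k ∧ (l.map (G.gen K)).prod = a}

theorem gen_mem (x : Gen V E) : G.gen K x ∈ G.leavittGrading K x.deg :=
  Submodule.subset_span ⟨[x], by simp, by simp⟩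

instance : SetLike.GradedMonoid (G.leavittGrading K) where
  one_mem := Submodule.subset_span ⟨[], by simp, by simp⟩
  mul_mem i j a b ha hb := by
    have h : a * b ∈ G.leavittGrading K i * G.leavittGrading K j := Submodule.mul_mem_mul ha hb
    rw [leavittGrading, leavittGrading, Submodule.span_mul_span] at h
    refine Submodule.span_mono ?_ h
    rintro _ ⟨_, ⟨l, hl, rfl⟩, _, ⟨l', hl', rfl⟩, rfl⟩
    exact ⟨l ++ l', by simp [hl, hl'], by simp⟩

/-- A generator as an element of its graded component. -/
noncomputable def genGraded (x : Gen V E) : ⨁ i, G.leavittGrading K i :=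
  DirectSum.of (fun i => G.leavittGrading K i) x.deg ⟨G.gen K x, G.gen_mem K x⟩

theorem gen_rel {a b : FreeAlgebra K (Gen V E)} (h : G.LeavittRel K a b) :
    RingQuot.mkAlgHom K (G.LeavittRel K) a = RingQuot.mkAlgHom K (G.LeavittRel K) b :=
  RingQuot.mkAlgHom_rel K h

theorem directSum_of_eq {i j : ℤ} (h : i = j) {a : G.leavittGrading K i}
    {b : G.leavittGrading K j} (hab : (a : G.LeavittPathAlgebra K) = b) :
    DirectSum.of (fun i => G.leavittGrading K i) i a = DirectSum.of _ j b := by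
  subst h
  exact congrArg _ (Subtype.ext hab)

/-- The splitting of elements of the Leavitt path algebra into homogeneous components. -/
noncomputable def decomposeHom : G.LeavittPathAlgebra K →ₐ[K] ⨁ i, G.leavittGrading K i :=
  RingQuot.liftAlgHom K ⟨FreeAlgebra.lift K (G.genGraded K), by
    intro a b h
    have h' := G.gen_rel K h
    cases h
    case one =>
      simp only [map_sum, map_one, FreeAlgebra.lift_ι_apply, genGraded] at h' ⊢
      refine (map_sum (DirectSum.of (fun i => G.leavittGrading K i) 0)
        (fun v => ⟨G.gen K (.vertex v), G.gen_mem K (.vertex v)⟩) _).symm.trans ?_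
      refine G.directSum_of_eq K rfl ?_
      rw [AddSubmonoidClass.coe_finsetSum]
      exact h'
    case vertex_orthogonal | ghost_edge_ne =>
      simp only [map_mul, map_zero, FreeAlgebra.lift_ι_apply, genGraded, DirectSum.of_mul_of]
        at h' ⊢
      exact (congrArg _ (Subtype.ext h')).trans (map_zero _)
    case sum_edge_ghost =>
      simp only [map_sum, map_mul, FreeAlgebra.lift_ι_apply, genGraded, DirectSum.of_mul_of]
        at h' ⊢
      refine (map_sum (DirectSum.of (fun i => G.leavittGrading K i) (1 + -1))
        (fun e => ⟨G.gen K (.edge e) * G.gen K (.ghost e),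
          SetLike.mul_mem_graded (G.gen_mem K (.edge e)) (G.gen_mem K (.ghost e))⟩) _).symm.trans ?_
      refine G.directSum_of_eq K (add_neg_cancel 1) ?_
      rw [AddSubmonoidClass.coe_finsetSum]
      exact h'
    all_goals
      simp only [map_mul, FreeAlgebra.lift_ι_apply, genGraded, DirectSum.of_mul_of] at h' ⊢
      exact G.directSum_of_eq K rfl h'⟩

theorem decomposeHom_gen (x : Gen V E) : G.decomposeHom K (G.gen K x) = G.genGraded K x := by
  rw [decomposeHom, gen, RingQuot.liftAlgHom_mkAlgHom_apply, FreeAlgebra.lift_ι_apply]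

/-- The Leavitt path algebra is a `ℤ`-graded algebra. -/
noncomputable instance : GradedAlgebra (G.leavittGrading K) := by
  refine GradedAlgebra.ofAlgHom _ (G.decomposeHom K) ?_ ?_
  · refine RingQuot.ringQuot_ext' K _ _ (FreeAlgebra.hom_ext (funext fun x => ?_))
    change DirectSum.coeAlgHom _ (G.decomposeHom K (G.gen K x)) = G.gen K x
    rw [decomposeHom_gen, genGraded, DirectSum.coeAlgHom_of]
  · have hl : ∀ l : List (Gen V E), ∀ i : ℤ, (l.map Gen.deg).sum = i →
        ∀ h : (l.map (G.gen K)).prod ∈ G.leavittGrading K i,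
        G.decomposeHom K (l.map (G.gen K)).prod =
          DirectSum.of (fun i => G.leavittGrading K i) i ⟨_, h⟩ := by
      intro l
      induction l with
      | nil =>
        rintro _ rfl h
        refine (map_one (G.decomposeHom K)).trans ?_
        exact G.directSum_of_eq K rfl rfl
      | cons x l ih =>
        rintro _ rfl h
        have hm : (l.map (G.gen K)).prod ∈ G.leavittGrading K (l.map Gen.deg).sum :=
          Submodule.subset_span ⟨l, rfl, rfl⟩
        simp only [List.map_cons, List.prod_cons, map_mul]
        rw [ih _ rfl hm, decomposeHom_gen, genGraded, DirectSum.of_mul_of]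
        exact G.directSum_of_eq K rfl rfl
    rintro i ⟨x, hx⟩
    change G.decomposeHom K x = _
    induction hx using Submodule.span_induction with
    | mem x h =>
      obtain ⟨l, hd, rfl⟩ := h
      exact hl l i hd _
    | zero => exact (map_zero _).trans (map_zero _).symm
    | add x y hx hy h₁ h₂ => rw [map_add, h₁, h₂, ← map_add]; rfl
    | smul c x hx h =>
      rw [map_smul, h]
      exact (map_smul (DirectSum.lof K ℤ (fun i => G.leavittGrading K i) i) c ⟨x, hx⟩).symm

end DirectedGraph

/-!
The graded Grothendieck group of `L_K(G)` is Krieger's dimension module of the adjacency matrix `A`.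
The relation `∑ α α* = v` splits the module generated by a vertex into the modules generated by the
ranges of its edges, shifted by one degree, so generators in one degree with counts `a` at the
vertices can be replaced by generators in the next degree with counts `a A`. A homogeneous element
of degree `0` involves only finitely many words, so after enough replacements every matrix entry
between generators is a linear combination of vertices, and linear algebra over `K` applies. Hence a
graded finitely generated projective module is described by vertex counts in a sufficiently large
degree, and two such descriptions `a`, `b` in the same degree satisfy `a A ^ n = b A ^ n` for
some `n`.

The variable `x` acts on the classes of the vertices through `A`. The matrices of a shift
equivalence therefore induce positive maps that are mutually inverse up to a power of `x`.
Conversely, a positive isomorphism and its inverse are given by nonnegative matrices after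
multiplication by powers of `x`, and these matrices satisfy the equations of a shift equivalence
after multiplication by powers of the adjacency matrices.
-/

open Filter
open DirectedGraph (Gen)

/-- The map out of the generators of a Leavitt path algebra given by three families, the values on
vertices, edges and ghost edges. -/
def DirectedGraph.Gen.elim {V E L : Type*} (vtx : V → L) (edge ghost : E → L) : Gen V E → L
  | .vertex v => vtx v
  | .edge e => edge e
  | .ghost e => ghost e

/-- A Leavitt path algebra structure on a graded algebra: vertices, edges and ghost edges that
satisfy the defining relations for a finite graph without sinks. The last two fields replace the
universal property: the vertices do not vanish, and words of degree `0` span the component of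
degree `0`. -/
structure LeavittFamily {K : Type*} [Field K] {V E : Type*} [Fintype V] [Fintype E] [DecidableEq V]
    (G : DirectedGraph V E) {L : Type*} [Ring L] [Algebra K L] (𝒜 : ℤ → Submodule K L) where
  vtx : V → L
  edge : E → L
  ghost : E → L
  sum_vtx : ∑ v, vtx v = 1
  vtx_mul_vtx : ∀ v w, vtx v * vtx w = if v = w then vtx v else 0
  s_edge : ∀ e, vtx (G.s e) * edge e = edge e
  edge_r : ∀ e, edge e * vtx (G.r e) = edge e
  r_ghost : ∀ e, vtx (G.r e) * ghost e = ghost e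
  ghost_s : ∀ e, ghost e * vtx (G.s e) = ghost e
  ghost_edge_self : ∀ e, ghost e * edge e = vtx (G.r e)
  ghost_edge_of_ne : ∀ e f, e ≠ f → ghost e * edge f = 0
  sum_edge_ghost : ∀ v, ∑ e : {e // G.s e = v}, edge e * ghost e = vtx v
  vtx_mem : ∀ v, vtx v ∈ 𝒜 0
  edge_mem : ∀ e, edge e ∈ 𝒜 1
  ghost_mem : ∀ e, ghost e ∈ 𝒜 (-1)
  vtx_ne_zero : ∀ v, vtx v ≠ 0
  mem_span : ∀ x ∈ 𝒜 0, x ∈ Submodule.span K {a | ∃ l : List (Gen V E),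
    (l.map Gen.deg).sum = 0 ∧ (l.map (Gen.elim vtx edge ghost)).prod = a}

namespace LeavittFamily

variable {K : Type*} [Field K] {V E : Type*} [Fintype V] [Fintype E] [DecidableEq V]
  {G : DirectedGraph V E} {L : Type*} [Ring L] [Algebra K L]
  {𝒜 : ℤ → Submodule K L} (Λ : LeavittFamily G 𝒜)

theorem vtx_mul_self (v : V) : Λ.vtx v * Λ.vtx v = Λ.vtx v := by rw [Λ.vtx_mul_vtx, if_pos rfl]

theorem ghost_mul_vtx (e : E) (v : V) :
    Λ.ghost e * Λ.vtx v = if G.s e = v then Λ.ghost e else 0 := by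
  rw [← Λ.ghost_s e, mul_assoc, Λ.vtx_mul_vtx]
  split_ifs <;> simp only [mul_zero]

theorem sum_edge_mul_ghost : ∑ e, Λ.edge e * Λ.ghost e = 1 := by
  rw [← Λ.sum_vtx, ← Fintype.sum_fiberwise G.s]
  exact Finset.sum_congr rfl fun v _ => Λ.sum_edge_ghost v

theorem sum_edge_mul_ghost_mul {v : V} {x : L} (hx : Λ.vtx v * x = x) :
    ∑ e : {e // G.s e = v}, Λ.edge e * (Λ.ghost e * x) = x := by
  simp only [← mul_assoc]
  rw [← Finset.sum_mul, Λ.sum_edge_ghost, hx]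

/-- The elements which `m` ghost edges on the left and `n` edges on the right always turn into
linear combinations of vertices. -/
def level : ℕ → ℕ → Submodule K L
  | 0, 0 => Submodule.span K (Set.range Λ.vtx)
  | 0, n + 1 => ⨅ f, (level 0 n).comap (LinearMap.mulRight K (Λ.edge f))
  | m + 1, n => ⨅ e, (level m n).comap (LinearMap.mulLeft K (Λ.ghost e))

theorem mem_level_zero {x : L} : x ∈ Λ.level 0 0 ↔ x ∈ Submodule.span K (Set.range Λ.vtx) := by
  rw [level]

theorem vtx_mem_level_zero (v : V) : Λ.vtx v ∈ Λ.level 0 0 :=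
  Λ.mem_level_zero.2 (Submodule.subset_span ⟨v, rfl⟩)

theorem mem_level_succ_left {m n : ℕ} {x : L} :
    x ∈ Λ.level (m + 1) n ↔ ∀ e, Λ.ghost e * x ∈ Λ.level m n := by
  simp only [level, Submodule.mem_iInf, Submodule.mem_comap, LinearMap.mulLeft_apply]

theorem mem_level_succ_right {m n : ℕ} {x : L} :
    x ∈ Λ.level m (n + 1) ↔ ∀ f, x * Λ.edge f ∈ Λ.level m n := by
  induction m generalizing x with
  | zero => simp only [level, Submodule.mem_iInf, Submodule.mem_comap, LinearMap.mulRight_apply]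
  | succ m ih =>
    simp only [mem_level_succ_left, ih, mul_assoc]
    exact forall_comm

theorem ghost_mul_mul_edge_mem_level {m n : ℕ} {x : L} (hx : x ∈ Λ.level (m + 1) (n + 1))
    (e f : E) : Λ.ghost e * x * Λ.edge f ∈ Λ.level m n :=
  Λ.mem_level_succ_right.1 (Λ.mem_level_succ_left.1 hx e) f

theorem level_zero_induction {x : L} {p : Submodule K L} (hx : x ∈ Λ.level 0 0)
    (h : ∀ v, Λ.vtx v ∈ p) : x ∈ p :=
  Submodule.span_le.2 (Set.range_subset_iff.2 h) (Λ.mem_level_zero.1 hx)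

theorem ghost_mul_vtx_mul_edge_mem_level_zero (e f : E) (v : V) :
    Λ.ghost e * Λ.vtx v * Λ.edge f ∈ Λ.level 0 0 := by
  rw [Λ.ghost_mul_vtx]
  split_ifs
  · obtain rfl | h := eq_or_ne e f
    · rw [Λ.ghost_edge_self]
      exact Λ.vtx_mem_level_zero _
    · rw [Λ.ghost_edge_of_ne e f h]
      exact zero_mem _
  · rw [zero_mul]
    exact zero_mem _

theorem level_le_level_succ (m n : ℕ) : Λ.level m n ≤ Λ.level (m + 1) (n + 1) := by
  intro x hx
  induction m generalizing x with
  | zero =>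
    induction n generalizing x with
    | zero =>
      refine Λ.mem_level_succ_left.2 fun e => Λ.mem_level_succ_right.2 fun f => ?_
      exact Λ.level_zero_induction
        (p := (Λ.level 0 0).comap (LinearMap.mulRight K (Λ.edge f) ∘ₗ
          LinearMap.mulLeft K (Λ.ghost e))) hx (Λ.ghost_mul_vtx_mul_edge_mem_level_zero e f)
    | succ n ih =>
      exact Λ.mem_level_succ_right.2 fun f => ih (Λ.mem_level_succ_right.1 hx f)
  | succ m ih => exact Λ.mem_level_succ_left.2 fun e => ih (Λ.mem_level_succ_left.1 hx e)

theorem vtx_mul_mem_level {m n : ℕ} {x : L} (hx : x ∈ Λ.level m n) (v : V) :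
    Λ.vtx v * x ∈ Λ.level m n := by
  cases m with
  | zero =>
    induction n generalizing x with
    | zero =>
      refine Λ.level_zero_induction (p := (Λ.level 0 0).comap (LinearMap.mulLeft K (Λ.vtx v))) hx
        fun w => ?_
      rw [Submodule.mem_comap, LinearMap.mulLeft_apply, Λ.vtx_mul_vtx]
      split_ifs
      · exact Λ.vtx_mem_level_zero v
      · exact zero_mem _
    | succ n ih =>
      refine Λ.mem_level_succ_right.2 fun f => ?_
      rw [mul_assoc]
      exact ih (Λ.mem_level_succ_right.1 hx f)
  | succ m =>
    refine Λ.mem_level_succ_left.2 fun e => ?_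
    rw [← mul_assoc, Λ.ghost_mul_vtx]
    split_ifs
    · exact Λ.mem_level_succ_left.1 hx e
    · rw [zero_mul]
      exact zero_mem _

theorem edge_mul_mem_level {m n : ℕ} {x : L} (hx : x ∈ Λ.level m n) (e : E) :
    Λ.edge e * x ∈ Λ.level (m + 1) n := by
  refine Λ.mem_level_succ_left.2 fun f => ?_
  rw [← mul_assoc]
  obtain rfl | h := eq_or_ne f e
  · rw [Λ.ghost_edge_self]
    exact Λ.vtx_mul_mem_level hx _
  · rw [Λ.ghost_edge_of_ne f e h, zero_mul]
    exact zero_mem _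

theorem ghost_mul_mem_level {m n : ℕ} {x : L} (hx : x ∈ Λ.level m n) (e : E) :
    Λ.ghost e * x ∈ Λ.level m (n + 1) :=
  Λ.mem_level_succ_left.1 (Λ.level_le_level_succ m n hx) e

theorem exists_word_mem_level (l : List (Gen V E)) : ∃ m n : ℕ, (m : ℤ) - n = (l.map Gen.deg).sum ∧
    (l.map (Gen.elim Λ.vtx Λ.edge Λ.ghost)).prod ∈ Λ.level m n := by
  induction l with
  | nil =>
    refine ⟨0, 0, by simp, ?_⟩
    rw [List.map_nil, List.prod_nil, ← Λ.sum_vtx]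
    exact sum_mem fun v _ => Λ.vtx_mem_level_zero v
  | cons g l ih =>
    obtain ⟨m, n, hd, h⟩ := ih
    simp only [List.map_cons, List.sum_cons, List.prod_cons, ← hd]
    cases g with
    | vertex v => exact ⟨m, n, (zero_add _).symm, Λ.vtx_mul_mem_level h v⟩
    | edge e => exact ⟨m + 1, n, by rw [Gen.deg, Nat.cast_succ]; ring, Λ.edge_mul_mem_level h e⟩
    | ghost e => exact ⟨m, n + 1, by rw [Gen.deg, Nat.cast_succ]; ring, Λ.ghost_mul_mem_level h e⟩

theorem eventually_mem_level {x : L} (hx : x ∈ 𝒜 0) : ∀ᶠ n in atTop, x ∈ Λ.level n n := by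
  have hmono : Monotone fun n => Λ.level n n :=
    monotone_nat_of_le_succ fun n => Λ.level_le_level_succ n n
  have hspan := Λ.mem_span x hx
  clear hx
  induction hspan using Submodule.span_induction with
  | mem x h =>
    obtain ⟨l, hl, rfl⟩ := h
    obtain ⟨m, n, hd, h⟩ := Λ.exists_word_mem_level l
    obtain rfl : m = n := by omega
    exact eventually_atTop.2 ⟨m, fun k hk => hmono hk h⟩
  | zero => exact .of_forall fun _ => zero_mem _
  | add x y _ _ hx hy => exact (hx.and hy).mono fun _ h => add_mem h.1 h.2
  | smul c x _ h => exact h.mono fun _ h => Submodule.smul_mem _ c h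

theorem exists_eq_smul_vtx {x : L} (hx : x ∈ Λ.level 0 0) {v w : V} (hv : Λ.vtx v * x = x)
    (hw : x * Λ.vtx w = x) : ∃ c : K, x = c • Λ.vtx v ∧ (v ≠ w → c = 0) := by
  obtain ⟨c, rfl⟩ := (Submodule.mem_span_range_iff_exists_fun K).1 (Λ.mem_level_zero.1 hx)
  have hcv : ∑ i, c i • Λ.vtx i = c v • Λ.vtx v := by
    rw [← hv, Finset.mul_sum]
    simp [Λ.vtx_mul_vtx]
  rw [hcv] at hw ⊢
  refine ⟨if v = w then c v else 0, ?_, fun h => if_neg h⟩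
  rw [← hw, smul_mul_assoc, Λ.vtx_mul_vtx]
  split_ifs <;> simp

theorem smul_vtx_injective (v : V) : Function.Injective fun c : K => c • Λ.vtx v :=
  smul_left_injective K (Λ.vtx_ne_zero v)

theorem sum_path_mul_ghost_path (k : ℕ) : ∑ l : Fin k → E,
    ((List.ofFn l).map Λ.edge).prod * ((List.ofFn l).reverse.map Λ.ghost).prod = 1 := by
  induction k with
  | zero => simp
  | succ k ih =>
    rw [← (Fin.consEquiv fun _ => E).sum_comp, Fintype.sum_prod_type, ← Λ.sum_edge_mul_ghost]
    refine Finset.sum_congr rfl fun e _ => ?_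
    simp only [Fin.consEquiv_apply, List.ofFn_succ, Fin.cons_zero, Fin.cons_succ, List.map_cons,
      List.prod_cons, List.reverse_cons, List.map_append, List.map_nil, List.prod_append,
      List.prod_nil, mul_one]
    calc _ = Λ.edge e * (∑ l : Fin k → E, ((List.ofFn l).map Λ.edge).prod *
          ((List.ofFn l).reverse.map Λ.ghost).prod) * Λ.ghost e := by
          simp only [Finset.mul_sum, Finset.sum_mul, mul_assoc]
      _ = _ := by rw [ih, mul_one]

end LeavittFamily

section GradedModules

theorem isInternal_comap_subtype {M σ τ : Type*} [AddCommGroup M] [SetLike σ M]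
    [AddSubgroupClass σ M] (ℳ : ℤ → σ) [DirectSum.Decomposition ℳ] [SetLike τ M]
    [AddSubgroupClass τ M] {N : τ} (hN : DirectSum.SetLike.IsHomogeneous ℳ N) :
    DirectSum.IsInternal fun i =>
      (AddSubgroup.ofClass (ℳ i)).comap (AddSubgroupClass.subtype N) := by
  classical
  let C (i : ℤ) : AddSubgroup N := (AddSubgroup.ofClass (ℳ i)).comap (AddSubgroupClass.subtype N)
  let ι (i : ℤ) : C i →+ ℳ i := AddMonoidHom.mk' (fun x => ⟨x.1, x.2⟩) fun _ _ => rfl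
  have hι : (DirectSum.coeAddMonoidHom ℳ).comp (DirectSum.map ι) =
      (AddSubgroupClass.subtype N).comp (DirectSum.coeAddMonoidHom C) := by
    refine DirectSum.addHom_ext' fun i => AddMonoidHom.ext fun x => ?_
    simp only [AddMonoidHom.comp_apply, DirectSum.map_of, DirectSum.coeAddMonoidHom_of]
    rfl
  constructor
  · refine .of_comp (f := AddSubgroupClass.subtype N) ?_
    rw [← AddMonoidHom.coe_comp, ← hι]
    refine (DirectSum.Decomposition.isInternal ℳ).injective.comp ?_
    exact (DirectSum.map_injective ι).2 fun i x y hxy =>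
      Subtype.ext (Subtype.ext (congrArg (fun z : ℳ i => (z : M)) hxy))
  · intro x
    refine ⟨∑ i ∈ (DirectSum.decompose ℳ (x : M)).support,
      DirectSum.of (fun i => C i) i ⟨⟨_, hN i x.2⟩, SetLike.coe_mem _⟩, Subtype.ext ?_⟩
    rw [map_sum, AddSubmonoidClass.coe_finsetSum]
    refine (Finset.sum_congr rfl fun i _ => ?_).trans (DirectSum.sum_support_decompose ℳ (x : M))
    rw [DirectSum.coeAddMonoidHom_of]

variable {A : Type u} [Ring A] {σ : Type v} [SetLike σ A] {𝒜 : ℤ → σ}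

theorem exists_finite_dual {A M : Type*} [Ring A] [AddCommGroup M] [Module Aᵐᵒᵖ M]
    [Module.Finite Aᵐᵒᵖ M] [Module.Projective Aᵐᵒᵖ M] :
    ∃ (n : ℕ) (p : Fin n → M) (f : Fin n → M →ₗ[Aᵐᵒᵖ] A), ∀ x, ∑ i, op (f i x) • p i = x := by
  obtain ⟨n, π, hπ⟩ := Module.Finite.exists_fin' Aᵐᵒᵖ M
  obtain ⟨s, hs⟩ := Module.projective_lifting_property π LinearMap.id hπ
  let unop : Aᵐᵒᵖ →ₗ[Aᵐᵒᵖ] A := ⟨⟨MulOpposite.unop, fun _ _ => rfl⟩, fun _ _ => rfl⟩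
  exact ⟨n, fun i => π fun j => if i = j then 1 else 0, fun i => unop ∘ₗ LinearMap.proj i ∘ₗ s,
    fun x => (LinearMap.pi_apply_eq_sum_univ π (s x)).symm.trans (DFunLike.congr_fun hs x)⟩

namespace GrProjModule

noncomputable instance (P : GrProjModule 𝒜) : DirectSum.Decomposition P.component :=
  P.isInternal.chooseDecomposition

/-- The projection of a graded module onto one of its homogeneous components. -/
noncomputable def proj (P : GrProjModule 𝒜) (k : ℤ) : P.carrier →+ P.carrier :=
  (P.component k).subtype.comp <|
    (DFinsupp.evalAddMonoidHom k).comp (DirectSum.decomposeAddEquiv P.component).toAddMonoidHom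

theorem proj_mem (P : GrProjModule 𝒜) (k : ℤ) (x : P.carrier) : P.proj k x ∈ P.component k :=
  (DirectSum.decompose P.component x k).2

theorem proj_same (P : GrProjModule 𝒜) {k : ℤ} {x : P.carrier} (hx : x ∈ P.component k) :
    P.proj k x = x :=
  DirectSum.decompose_of_mem_same P.component hx

theorem proj_of_ne (P : GrProjModule 𝒜) {k l : ℤ} {x : P.carrier} (hx : x ∈ P.component k)
    (h : k ≠ l) : P.proj l x = 0 :=
  DirectSum.decompose_of_mem_ne P.component hx h

theorem exists_sum_proj (P : GrProjModule 𝒜) (x : P.carrier) :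
    ∃ S : Finset ℤ, ∑ k ∈ S, P.proj k x = x := by
  classical
  exact ⟨_, DirectSum.sum_support_decompose P.component x⟩

variable [AddSubgroupClass σ A] [GradedRing 𝒜]

theorem proj_smul (P : GrProjModule 𝒜) {d : ℤ} {x : P.carrier} (hx : x ∈ P.component d) (a : A)
    (k : ℤ) : P.proj k (op a • x) = op (GradedRing.proj 𝒜 (k - d) a) • x := by
  induction a using DirectSum.Decomposition.inductionOn 𝒜 with
  | zero => simp
  | @homogeneous j a =>
    have h := P.smul_mem hx a.2
    obtain rfl | hk := eq_or_ne (d + j) k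
    · rw [P.proj_same h, GradedRing.proj_apply, add_sub_cancel_left,
        DirectSum.decompose_of_mem_same 𝒜 a.2]
    · rw [P.proj_of_ne h hk, GradedRing.proj_apply, DirectSum.decompose_of_mem_ne 𝒜 a.2 (by omega),
        MulOpposite.op_zero, zero_smul]
  | add a b ha hb =>
    rw [MulOpposite.op_add, add_smul, map_add, ha, hb, map_add, MulOpposite.op_add, add_smul]

theorem exists_homogeneous_part (P : GrProjModule 𝒜) (f : P.carrier →ₗ[Aᵐᵒᵖ] A) (d : ℤ) :
    ∃ g : P.carrier →ₗ[Aᵐᵒᵖ] A, ∀ k, ∀ x ∈ P.component k,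
      g x = GradedRing.proj 𝒜 (k - d) (f x) := by
  let g : P.carrier →+ A := (DirectSum.toAddMonoid fun k => (GradedRing.proj 𝒜 (k - d)).comp
    (f.toAddMonoidHom.comp (P.component k).subtype)).comp
    (DirectSum.decomposeAddEquiv P.component).toAddMonoidHom
  have hg : ∀ k, ∀ x ∈ P.component k, g x = GradedRing.proj 𝒜 (k - d) (f x) := by
    intro k x hx
    have hdec : DirectSum.decomposeAddEquiv P.component x = DirectSum.of _ k ⟨x, hx⟩ :=
      DirectSum.decompose_of_mem P.component hx
    change DirectSum.toAddMonoid _ (DirectSum.decomposeAddEquiv P.component x) = _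
    rw [hdec, DirectSum.toAddMonoid_of]
    rfl
  refine ⟨⟨⟨g, map_add g⟩, fun a x => ?_⟩, hg⟩
  induction a using MulOpposite.rec' with | _ a =>
  change g (op a • x) = g x * a
  induction x using DirectSum.Decomposition.inductionOn P.component with
  | zero => simp
  | @homogeneous k x =>
    induction a using DirectSum.Decomposition.inductionOn 𝒜 with
    | zero => simp
    | @homogeneous j a =>
      rw [hg _ _ (P.smul_mem x.2 a.2), hg _ _ x.2, map_smul]
      change GradedRing.proj 𝒜 _ (f x * a) = _
      rw [GradedRing.proj_apply, GradedRing.proj_apply, add_sub_right_comm,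
        ← DirectSum.coe_decompose_mul_add_of_right_mem 𝒜 a.2]
    | add a b ha hb => rw [MulOpposite.op_add, add_smul, map_add, ha, hb, mul_add]
  | add x y hx hy => rw [smul_add, map_add, hx, hy, map_add, add_mul]

theorem exists_homogeneous_dual (P : GrProjModule 𝒜) :
    ∃ (ι : Type) (_ : Fintype ι) (d : ι → ℤ) (p : ι → P.carrier)
      (f : ι → P.carrier →ₗ[Aᵐᵒᵖ] A), (∀ i, p i ∈ P.component (d i)) ∧
      (∀ i k, ∀ x ∈ P.component k, f i x ∈ 𝒜 (k - d i)) ∧ ∀ x, ∑ i, op (f i x) • p i = x := by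
  obtain ⟨n, p, f, hpf⟩ := exists_finite_dual (A := A) (M := P.carrier)
  choose S hS using fun i => P.exists_sum_proj (p i)
  choose g hg using fun i => P.exists_homogeneous_part (f i)
  refine ⟨Σ i, S i, inferInstance, fun i => i.2, fun i => P.proj i.2 (p i.1), fun i => g i.1 i.2,
    fun i => P.proj_mem _ _, fun i k x hx => ?_, fun x => ?_⟩
  · rw [hg _ _ _ x hx]
    exact SetLike.coe_mem _
  · induction x using DirectSum.Decomposition.inductionOn P.component with
    | zero => simp
    | @homogeneous k x =>
      conv_rhs => rw [← P.proj_same x.2, ← hpf x, map_sum]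
      rw [Fintype.sum_sigma]
      refine Finset.sum_congr rfl fun i _ => ?_
      conv_rhs => rw [← hS i, Finset.smul_sum, map_sum, ← Finset.sum_coe_sort]
      refine Finset.sum_congr rfl fun d _ => ?_
      rw [P.proj_smul (P.proj_mem _ _), hg i d k x x.2]
    | add x y hx hy =>
      conv_rhs => rw [← hx, ← hy]
      simp only [map_add, MulOpposite.op_add, add_smul, Finset.sum_add_distrib]

/-- The right ideal `eA` generated by an idempotent `e` of degree `0`, as a graded projective
module. -/
noncomputable def ofIdempotent {e : A} (he : e * e = e) (he₀ : e ∈ 𝒜 0) : GrProjModule 𝒜 :=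
  let M : Submodule Aᵐᵒᵖ A := LinearMap.eqLocus (LinearMap.mulLeft Aᵐᵒᵖ e) LinearMap.id
  let ι : M →ₗ[Aᵐᵒᵖ] Aᵐᵒᵖ := ⟨⟨fun x => op x.1, fun _ _ => rfl⟩, fun _ _ => rfl⟩
  let π : Aᵐᵒᵖ →ₗ[Aᵐᵒᵖ] M := LinearMap.toSpanSingleton Aᵐᵒᵖ M ⟨e, he⟩
  have hπ : π ∘ₗ ι = LinearMap.id := LinearMap.ext fun x => Subtype.ext x.2
  { carrier := M
    component := fun i => (AddSubgroup.ofClass (𝒜 i)).comap (AddSubgroupClass.subtype M)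
    isInternal := isInternal_comap_subtype 𝒜 fun i x hx => by
      change e * _ = _
      rw [← DirectSum.coe_decompose_mul_of_left_mem_zero 𝒜 he₀, show e * x = x from hx]
      rfl
    smul_mem := fun hx ha => SetLike.mul_mem_graded (A := 𝒜) hx ha
    finite := .of_surjective π fun x => ⟨ι x, DFunLike.congr_fun hπ x⟩
    projective := .of_split ι π hπ }

end GrProjModule

end GradedModules

section Frames

variable {K : Type*} [Field K] {V : Type v} {E : Type w} [Fintype V] [Fintype E] [DecidableEq V]
  {G : DirectedGraph V E} {L : Type u} [Ring L] [Algebra K L] {𝒜 : ℤ → Submodule K L}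

/-- A homogeneous dual generating system of the graded module `P`: generators `p i` of degree `N`
supported at the vertices `v i`, and coordinate functions `f i` of degree `-N`. -/
structure GrFrame (Λ : LeavittFamily G 𝒜) (P : GrProjModule 𝒜) (N : ℤ) {I : Type*} [Fintype I]
    (v : I → V) where
  p : I → P.carrier
  f : I → P.carrier →ₗ[Lᵐᵒᵖ] L
  p_mem : ∀ i, p i ∈ P.component N
  f_mem : ∀ i k x, x ∈ P.component k → f i x ∈ 𝒜 (k - N)
  p_vtx : ∀ i, op (Λ.vtx (v i)) • p i = p i
  vtx_f : ∀ i x, Λ.vtx (v i) * f i x = f i x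
  sum_eq : ∀ x, ∑ i, op (f i x) • p i = x

namespace GrFrame

variable {Λ : LeavittFamily G 𝒜} {P Q : GrProjModule 𝒜} {N : ℤ} {I J : Type*} [Fintype I]
  [Fintype J] {v : I → V} {w : J → V}

theorem f_op_smul (F : GrFrame Λ P N v) (i : I) (a : L) (x : P.carrier) :
    F.f i (op a • x) = F.f i x * a :=
  map_smul (F.f i) (op a) x

theorem f_p_mul_vtx (F : GrFrame Λ P N v) (B : GrFrame Λ P N w) (i : I) (j : J) :
    F.f i (B.p j) * Λ.vtx (w j) = F.f i (B.p j) := by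
  rw [← F.f_op_smul, B.p_vtx]

theorem f_p_mem (F : GrFrame Λ P N v) (B : GrFrame Λ P N w) (i : I) (j : J) :
    F.f i (B.p j) ∈ 𝒜 0 := by
  simpa using F.f_mem i N _ (B.p_mem j)

/-- The frame `F` is a basis if its generators and its coordinate functions are dual to each other.
This identifies `P` with the direct sum of the right ideals generated by the vertices `v i`,
shifted by `-N`. -/
structure IsBasis (F : GrFrame Λ P N v) : Prop where
  f_p_self : ∀ i, F.f i (F.p i) = Λ.vtx (v i)
  f_p_of_ne : ∀ i j, i ≠ j → F.f i (F.p j) = 0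

/-- The frame obtained by relabelling the generators along a bijection of index sets. -/
def reindex (F : GrFrame Λ P N v) (e : J ≃ I) (h : ∀ j, v (e j) = w j) : GrFrame Λ P N w where
  p j := F.p (e j)
  f j := F.f (e j)
  p_mem _ := F.p_mem _
  f_mem _ := F.f_mem _
  p_vtx j := by rw [← h, F.p_vtx]
  vtx_f j x := by rw [← h, F.vtx_f]
  sum_eq x := (Equiv.sum_comp e fun i => op (F.f i x) • F.p i).trans (F.sum_eq x)

theorem IsBasis.reindex {F : GrFrame Λ P N v} (hF : F.IsBasis) (e : J ≃ I)
    (h : ∀ j, v (e j) = w j) : (F.reindex e h).IsBasis where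
  f_p_self j := (hF.f_p_self (e j)).trans (by rw [h])
  f_p_of_ne _ _ hij := hF.f_p_of_ne _ _ (e.injective.ne hij)

/-- The image of a frame under a graded isomorphism. -/
def map (F : GrFrame Λ P N v) (φ : P.carrier ≃ₗ[Lᵐᵒᵖ] Q.carrier)
    (hφ : ∀ i x, φ x ∈ Q.component i ↔ x ∈ P.component i) : GrFrame Λ Q N v where
  p i := φ (F.p i)
  f i := F.f i ∘ₗ φ.symm.toLinearMap
  p_mem i := (hφ _ _).2 (F.p_mem i)
  f_mem i k x hx := F.f_mem i k _ ((hφ _ _).1 (by simpa using hx))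
  p_vtx i := by rw [← map_smul, F.p_vtx]
  vtx_f i x := F.vtx_f i _
  sum_eq x := by
    simpa [map_sum] using congrArg φ (F.sum_eq (φ.symm x))

theorem IsBasis.map {F : GrFrame Λ P N v} (hF : F.IsBasis) (φ : P.carrier ≃ₗ[Lᵐᵒᵖ] Q.carrier)
    (hφ : ∀ i x, φ x ∈ Q.component i ↔ x ∈ P.component i) : (F.map φ hφ).IsBasis where
  f_p_self i := (congrArg (F.f i) (φ.symm_apply_apply _)).trans (hF.f_p_self i)
  f_p_of_ne i j h := (congrArg (F.f i) (φ.symm_apply_apply _)).trans (hF.f_p_of_ne i j h)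

/-- A frame of a graded module as a frame of a shift of this module. -/
def shift (F : GrFrame Λ P N v) (k : ℤ) : GrFrame Λ (P.shift k) (N - k) v where
  p := F.p
  f := F.f
  p_mem i := by
    change F.p i ∈ P.component (k + (N - k))
    rw [add_sub_cancel]
    exact F.p_mem i
  f_mem i l x hx := by
    rw [show l - (N - k) = k + l - N by ring]
    exact F.f_mem i (k + l) x hx
  p_vtx := F.p_vtx
  vtx_f := F.vtx_f
  sum_eq := F.sum_eq

theorem IsBasis.shift {F : GrFrame Λ P N v} (hF : F.IsBasis) (k : ℤ) : (F.shift k).IsBasis :=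
  ⟨hF.f_p_self, hF.f_p_of_ne⟩

/-- The frame of a direct sum made of frames of the summands. -/
def prod (F : GrFrame Λ P N v) (B : GrFrame Λ Q N w) :
    GrFrame Λ (P.prod Q) N (Sum.elim v w) where
  p := Sum.elim (fun i => LinearMap.inl Lᵐᵒᵖ P.carrier Q.carrier (F.p i))
    fun j => LinearMap.inr Lᵐᵒᵖ P.carrier Q.carrier (B.p j)
  f := Sum.elim (fun i => F.f i ∘ₗ LinearMap.fst Lᵐᵒᵖ P.carrier Q.carrier)
    fun j => B.f j ∘ₗ LinearMap.snd Lᵐᵒᵖ P.carrier Q.carrier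
  p_mem := Sum.rec (fun i => ⟨F.p_mem i, zero_mem _⟩) fun j => ⟨zero_mem _, B.p_mem j⟩
  f_mem := Sum.rec (fun i k _ hx => F.f_mem i k _ hx.1) fun j k _ hx => B.f_mem j k _ hx.2
  p_vtx := Sum.rec (fun i => Prod.ext (F.p_vtx i) (smul_zero _))
    fun j => Prod.ext (smul_zero _) (B.p_vtx j)
  vtx_f := Sum.rec (fun i x => F.vtx_f i x.1) fun j x => B.vtx_f j x.2
  sum_eq x := by
    rw [Fintype.sum_sum_type]
    have hF := congrArg (LinearMap.inl Lᵐᵒᵖ P.carrier Q.carrier) (F.sum_eq x.1)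
    have hB := congrArg (LinearMap.inr Lᵐᵒᵖ P.carrier Q.carrier) (B.sum_eq x.2)
    simp only [map_sum, map_smul] at hF hB
    exact (congrArg₂ (· + ·) hF hB).trans (Prod.fst_add_snd x)

theorem IsBasis.prod {F : GrFrame Λ P N v} {B : GrFrame Λ Q N w} (hF : F.IsBasis)
    (hB : B.IsBasis) : (F.prod B).IsBasis where
  f_p_self := Sum.rec hF.f_p_self hB.f_p_self
  f_p_of_ne := by
    rintro (i | i) (j | j) h
    · exact hF.f_p_of_ne i j fun h' => h (congrArg _ h')
    · exact map_zero (F.f i)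
    · exact map_zero (B.f i)
    · exact hB.f_p_of_ne i j fun h' => h (congrArg _ h')

section Hom

variable (F : GrFrame Λ P N v) (B : GrFrame Λ Q N v)

/-- The homomorphism that matches the generators of two frames. -/
noncomputable def hom : P.carrier →ₗ[Lᵐᵒᵖ] Q.carrier where
  toFun x := ∑ i, op (F.f i x) • B.p i
  map_add' x y := by
    simp only [map_add, MulOpposite.op_add, add_smul, Finset.sum_add_distrib]
  map_smul' a x := by
    induction a using MulOpposite.rec' with | _ a =>
    simp only [F.f_op_smul, RingHom.id_apply, Finset.smul_sum, smul_smul, MulOpposite.op_mul]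

theorem hom_apply (x : P.carrier) : F.hom B x = ∑ i, op (F.f i x) • B.p i := rfl

theorem hom_mem {k : ℤ} {x : P.carrier} (hx : x ∈ P.component k) :
    F.hom B x ∈ Q.component k := by
  rw [hom_apply]
  refine sum_mem fun i _ => ?_
  simpa only [add_sub_cancel] using Q.smul_mem (B.p_mem i) (F.f_mem i k x hx)

variable {B}

theorem hom_hom (hB : B.IsBasis) (x : P.carrier) : B.hom F (F.hom B x) = x := by
  have h (i : I) : B.f i (F.hom B x) = F.f i x := by
    rw [hom_apply, map_sum, Fintype.sum_eq_single i fun j hj => ?_]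
    · rw [B.f_op_smul, hB.f_p_self, F.vtx_f]
    · rw [B.f_op_smul, hB.f_p_of_ne i j hj.symm, zero_mul]
  rw [hom_apply]
  simp only [h, F.sum_eq]

variable {F}

theorem IsBasis.grIso (hF : F.IsBasis) (hB : B.IsBasis) : GrProjModule.GrIso P Q :=
  ⟨.ofLinearMap (F.hom B) (B.hom F) (LinearMap.ext (B.hom_hom hF))
    (LinearMap.ext (F.hom_hom hB)), fun _ x =>
    ⟨fun h => F.hom_hom hB x ▸ B.hom_mem F h, F.hom_mem B⟩⟩

end Hom

section Refine

variable [SetLike.GradedMonoid 𝒜]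

/-- The frame obtained by multiplying the generators of a frame by the edges that start at their
vertices. -/
def refine (F : GrFrame Λ P N v) :
    GrFrame Λ P (N + 1) (fun i : (Σ i, {e // G.s e = v i}) => G.r i.2) where
  p i := op (Λ.edge i.2) • F.p i.1
  f i := LinearMap.mulLeft Lᵐᵒᵖ (Λ.ghost i.2) ∘ₗ F.f i.1
  p_mem i := P.smul_mem (F.p_mem _) (Λ.edge_mem _)
  f_mem i k x hx := by
    rw [show k - (N + 1) = -1 + (k - N) by ring]
    exact SetLike.mul_mem_graded (Λ.ghost_mem i.2) (F.f_mem i.1 k x hx)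
  p_vtx i := by rw [smul_smul, ← MulOpposite.op_mul, Λ.edge_r]
  vtx_f i x := by
    rw [LinearMap.comp_apply, LinearMap.mulLeft_apply, ← mul_assoc, Λ.r_ghost]
  sum_eq x := by
    conv_rhs => rw [← F.sum_eq x]
    rw [Fintype.sum_sigma]
    refine Finset.sum_congr rfl fun i _ => ?_
    conv_rhs => rw [← Λ.sum_edge_mul_ghost_mul (F.vtx_f i x), Finset.op_sum, Finset.sum_smul]
    simp only [smul_smul, ← MulOpposite.op_mul, LinearMap.comp_apply, LinearMap.mulLeft_apply]

theorem refine_f_refine_p (F : GrFrame Λ P N v) (B : GrFrame Λ P N w)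
    (i : Σ i, {e // G.s e = v i}) (j : Σ j, {e // G.s e = w j}) :
    F.refine.f i (B.refine.p j) = Λ.ghost i.2 * F.f i.1 (B.p j.1) * Λ.edge j.2 := by
  change Λ.ghost i.2 * F.f i.1 (op _ • _) = _
  rw [f_op_smul, mul_assoc]

theorem IsBasis.refine {F : GrFrame Λ P N v} (hF : F.IsBasis) : F.refine.IsBasis where
  f_p_self := by
    rintro ⟨i, e⟩
    rw [refine_f_refine_p, hF.f_p_self, Λ.ghost_mul_vtx, if_pos e.2, Λ.ghost_edge_self]
  f_p_of_ne := by
    rintro ⟨i, e⟩ ⟨j, f⟩ h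
    rw [refine_f_refine_p]
    obtain rfl | hij := eq_or_ne i j
    · rw [hF.f_p_self, Λ.ghost_mul_vtx, if_pos e.2, Λ.ghost_edge_of_ne]
      exact fun h' => h (congrArg _ (Subtype.ext h'))
    · rw [hF.f_p_of_ne i j hij, mul_zero, zero_mul]

end Refine

end GrFrame

theorem LeavittFamily.list_map_edge_prod_mem [SetLike.GradedMonoid 𝒜] (Λ : LeavittFamily G 𝒜)
    (l : List E) : (l.map Λ.edge).prod ∈ 𝒜 l.length := by
  simpa using SetLike.list_prod_map_mem_graded (A := 𝒜) l (fun _ => 1) _ fun e _ => Λ.edge_mem e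

theorem LeavittFamily.list_map_ghost_prod_mem [SetLike.GradedMonoid 𝒜] (Λ : LeavittFamily G 𝒜)
    (l : List E) : (l.map Λ.ghost).prod ∈ 𝒜 (-l.length) := by
  simpa using SetLike.list_prod_map_mem_graded (A := 𝒜) l (fun _ => -1) _ fun e _ => Λ.ghost_mem e

theorem LeavittFamily.sum_vtx_sum_path_mul_ghost_path (Λ : LeavittFamily G 𝒜) (k : ℕ) :
    ∑ i : V × (Fin k → E), ((List.ofFn i.2).map Λ.edge).prod * Λ.vtx i.1 *
      (Λ.vtx i.1 * ((List.ofFn i.2).reverse.map Λ.ghost).prod) = 1 := by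
  rw [Fintype.sum_prod_type_right, ← Λ.sum_path_mul_ghost_path k]
  refine Finset.sum_congr rfl fun l _ => ?_
  simp only [mul_assoc]
  rw [← Finset.mul_sum]
  simp only [← mul_assoc, Λ.vtx_mul_self]
  rw [← Finset.sum_mul, Λ.sum_vtx, one_mul]

theorem exists_grFrame [GradedRing 𝒜] (Λ : LeavittFamily G 𝒜) (P : GrProjModule 𝒜) :
    ∃ (N : ℤ) (I : Type (max v w)) (_ : Fintype I) (v : I → V), Nonempty (GrFrame Λ P N v) := by
  obtain ⟨ι, _, d, p, f, hp, hf, hpf⟩ := P.exists_homogeneous_dual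
  obtain ⟨N, hN⟩ := (Set.finite_range d).bddAbove
  choose k hk using fun i => Int.le.dest (hN ⟨i, rfl⟩)
  exact ⟨N, Σ i, V × (Fin (k i) → E), inferInstance, fun i => i.2.1, ⟨{
    p := fun i => op (((List.ofFn i.2.2).map Λ.edge).prod * Λ.vtx i.2.1) • p i.1
    f := fun i => LinearMap.mulLeft Lᵐᵒᵖ
      (Λ.vtx i.2.1 * ((List.ofFn i.2.2).reverse.map Λ.ghost).prod) ∘ₗ f i.1
    p_mem := fun i => by
      have h := SetLike.mul_mem_graded (Λ.list_map_edge_prod_mem (List.ofFn i.2.2))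
        (Λ.vtx_mem i.2.1)
      rw [List.length_ofFn, add_zero] at h
      exact hk i.1 ▸ P.smul_mem (hp i.1) h
    f_mem := fun i n x hx => by
      have h := SetLike.mul_mem_graded (SetLike.mul_mem_graded (Λ.vtx_mem i.2.1)
        (Λ.list_map_ghost_prod_mem (List.ofFn i.2.2).reverse)) (hf i.1 n x hx)
      rwa [List.length_reverse, List.length_ofFn, show (0 : ℤ) + -(k i.1) + (n - d i.1) = n - N by
        rw [← hk i.1]; ring] at h
    p_vtx := fun i => by rw [smul_smul, ← MulOpposite.op_mul, mul_assoc, Λ.vtx_mul_self]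
    vtx_f := fun i x => by
      rw [LinearMap.comp_apply, LinearMap.mulLeft_apply, ← mul_assoc, ← mul_assoc, Λ.vtx_mul_self]
    sum_eq := fun x => by
      rw [Fintype.sum_sigma]
      refine (Finset.sum_congr rfl fun i _ => ?_).trans (hpf x)
      conv_rhs => rw [← one_mul (f i x), ← Λ.sum_vtx_sum_path_mul_ghost_path (k i),
        Finset.sum_mul, Finset.op_sum, Finset.sum_smul]
      simp only [smul_smul, ← MulOpposite.op_mul, LinearMap.comp_apply, LinearMap.mulLeft_apply,
        mul_assoc] }⟩⟩

end Frames

section Bases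

variable {K : Type*} [Field K] {V : Type v} {E : Type w} [Fintype V] [Fintype E] [DecidableEq V]
  {G : DirectedGraph V E} {L : Type u} [Ring L] [Algebra K L] {𝒜 : ℤ → Submodule K L}

noncomputable instance (P : GrProjModule 𝒜) : Module K P.carrier :=
  Module.compHom P.carrier (algebraMap K Lᵐᵒᵖ)

instance (P : GrProjModule 𝒜) : IsScalarTower K Lᵐᵒᵖ P.carrier :=
  .of_algebraMap_smul fun _ _ => rfl

namespace GrFrame

variable {Λ : LeavittFamily G 𝒜} {P : GrProjModule 𝒜} {N : ℤ} {I J : Type*} [Fintype I]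
  [Fintype J] {v : I → V} {w : J → V}

theorem eventually_level (F : GrFrame Λ P N v) (B : GrFrame Λ P N w) :
    ∀ᶠ n in atTop, ∀ i j, F.f i (B.p j) ∈ Λ.level n n :=
  eventually_all.2 fun i => eventually_all.2 fun j => Λ.eventually_mem_level (F.f_p_mem B i j)

theorem exists_coeff_of_level_zero (F : GrFrame Λ P N v) (B : GrFrame Λ P N w)
    (h : ∀ i j, F.f i (B.p j) ∈ Λ.level 0 0) : ∃ c : I → J → K,
      (∀ i j, F.f i (B.p j) = c i j • Λ.vtx (v i)) ∧ (∀ i j, v i ≠ w j → c i j = 0) ∧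
      ∀ j, ∑ i, c i j • F.p i = B.p j := by
  choose c hc hc₀ using fun i j =>
    Λ.exists_eq_smul_vtx (h i j) (F.vtx_f i _) (F.f_p_mul_vtx B i j)
  refine ⟨c, hc, hc₀, fun j => ?_⟩
  conv_rhs => rw [← F.sum_eq (B.p j)]
  refine Finset.sum_congr rfl fun i _ => ?_
  rw [hc, MulOpposite.op_smul, smul_assoc, F.p_vtx]

theorem isBasis_of_linearIndependent {F : GrFrame Λ P N v} (hF : LinearIndependent K F.p)
    (h : ∀ i j, F.f i (F.p j) ∈ Λ.level 0 0) : F.IsBasis := by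
  classical
  obtain ⟨c, hc, -, hsum⟩ := F.exists_coeff_of_level_zero F h
  have hc' (i j : I) : c i j = (Pi.single j 1 : I → K) i := by
    refine congrFun (hF.fintypeLinearCombination_injective (a₁ := fun i => c i j) ?_) i
    simp [Fintype.linearCombination_apply, hsum]
  exact ⟨fun i => by rw [hc, hc', Pi.single_eq_same, one_smul],
    fun i j hij => by rw [hc, hc', Pi.single_eq_of_ne hij, zero_smul]⟩

theorem IsBasis.linearIndependent {F : GrFrame Λ P N v} (hF : F.IsBasis) :
    LinearIndependent K F.p := by
  refine Fintype.linearIndependent_iff.2 fun c hc i => Λ.smul_vtx_injective (v i) ?_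
  have h := congrArg (F.f i) hc
  rw [map_sum, Fintype.sum_eq_single i fun j hj => ?_] at h
  · simpa only [LinearMap.map_smul_of_tower, hF.f_p_self, map_zero, zero_smul] using h
  · rw [LinearMap.map_smul_of_tower, hF.f_p_of_ne i j hj.symm, smul_zero]

theorem IsBasis.card_le_of_level_zero {B : GrFrame Λ P N w} (hB : B.IsBasis)
    (F : GrFrame Λ P N v) (h : ∀ i j, F.f i (B.p j) ∈ Λ.level 0 0) (u : V) :
    Fintype.card {j // w j = u} ≤ Fintype.card {i // v i = u} := by
  obtain ⟨c, -, hc, hsum⟩ := F.exists_coeff_of_level_zero B h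
  have hspan : Set.range (fun j : {j // w j = u} => B.p j) ⊆
      Submodule.span K (Set.range fun i : {i // v i = u} => F.p i) := by
    rintro _ ⟨⟨j, rfl⟩, rfl⟩
    rw [SetLike.mem_coe]
    beta_reduce
    rw [← hsum]
    refine sum_mem fun i _ => ?_
    obtain hi | hi := eq_or_ne (v i) (w j)
    · exact Submodule.smul_mem _ _ (Submodule.subset_span ⟨⟨i, hi⟩, rfl⟩)
    · rw [hc i j hi, zero_smul]
      exact zero_mem _
  have hLI := hB.linearIndependent.comp _ (Subtype.val_injective (p := fun j => w j = u))
  have := FiniteDimensional.span_of_finite K (Set.finite_range fun i : {i // v i = u} => F.p i)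
  calc Fintype.card {j // w j = u} = (Set.range fun j : {j // w j = u} => B.p j).finrank K :=
        (linearIndependent_iff_card_eq_finrank_span.1 hLI)
    _ ≤ (Set.range fun i : {i // v i = u} => F.p i).finrank K :=
        Submodule.finrank_mono (Submodule.span_le.2 hspan)
    _ ≤ Fintype.card {i // v i = u} := finrank_range_le_card _

section Elimination

variable [SetLike.GradedMonoid 𝒜]

/-- The frame consisting of those generators `p (a j)` of `F` of which all others are linear
combinations, with coefficients `t i j`. -/
def subframe (F : GrFrame Λ P N v) (a : J → I) (t : I → J → K)
    (h : ∀ i, ∑ j, t i j • F.p (a j) = F.p i) : GrFrame Λ P N (fun j => v (a j)) where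
  p j := F.p (a j)
  f j := LinearMap.mulLeft Lᵐᵒᵖ (Λ.vtx (v (a j))) ∘ₗ ∑ i, t i j • F.f i
  p_mem j := F.p_mem _
  f_mem j k x hx := by
    rw [← zero_add (k - N), LinearMap.comp_apply, LinearMap.sum_apply]
    exact SetLike.mul_mem_graded (Λ.vtx_mem _)
      (sum_mem fun i _ => Submodule.smul_mem _ _ (F.f_mem i k x hx))
  p_vtx j := F.p_vtx _
  vtx_f j x := by
    rw [LinearMap.comp_apply, LinearMap.mulLeft_apply, ← mul_assoc, Λ.vtx_mul_self]
  sum_eq x := by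
    calc _ = ∑ j, ∑ i, op (F.f i x) • t i j • F.p (a j) := by
          refine Finset.sum_congr rfl fun j _ => ?_
          rw [LinearMap.comp_apply, LinearMap.mulLeft_apply, MulOpposite.op_mul, mul_smul,
            F.p_vtx, LinearMap.sum_apply, Finset.op_sum, Finset.sum_smul]
          simp only [LinearMap.smul_apply, MulOpposite.op_smul, smul_assoc, smul_comm (t _ j)]
      _ = x := by
          rw [Finset.sum_comm]
          simp only [← Finset.smul_sum, h, F.sum_eq]

theorem subframe_level_zero {F : GrFrame Λ P N v} (hF : ∀ i j, F.f i (F.p j) ∈ Λ.level 0 0)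
    {a : J → I} {t : I → J → K} (h : ∀ i, ∑ j, t i j • F.p (a j) = F.p i) (j k : J) :
    (F.subframe a t h).f j ((F.subframe a t h).p k) ∈ Λ.level 0 0 := by
  refine Λ.vtx_mul_mem_level ?_ _
  rw [LinearMap.sum_apply]
  exact sum_mem fun i _ => Submodule.smul_mem _ _ (hF i (a k))

theorem exists_isBasis_of_level_zero {I : Type (max v w)} [Fintype I] {v : I → V}
    (F : GrFrame Λ P N v) (hF : ∀ i j, F.f i (F.p j) ∈ Λ.level 0 0) :
    ∃ (J : Type (max v w)) (_ : Fintype J) (a : J → I) (B : GrFrame Λ P N (fun j => v (a j))),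
      B.IsBasis := by
  obtain ⟨J, a, ha, hspan, hLI⟩ := exists_linearIndependent' K F.p
  have := Fintype.ofInjective a ha
  have hmem (i : I) : F.p i ∈ Submodule.span K (Set.range (F.p ∘ a)) :=
    hspan ▸ Submodule.subset_span ⟨i, rfl⟩
  choose t ht using fun i => (Submodule.mem_span_range_iff_exists_fun K).1 (hmem i)
  exact ⟨J, this, a, F.subframe a t ht, isBasis_of_linearIndependent hLI
    (subframe_level_zero hF ht)⟩

theorem refine_level {F : GrFrame Λ P N v} {B : GrFrame Λ P N w} {n : ℕ}
    (h : ∀ i j, F.f i (B.p j) ∈ Λ.level (n + 1) (n + 1)) (i : Σ i, {e // G.s e = v i})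
    (j : Σ j, {e // G.s e = w j}) : F.refine.f i (B.refine.p j) ∈ Λ.level n n := by
  rw [refine_f_refine_p]
  exact Λ.ghost_mul_mul_edge_mem_level (h _ _) _ _

theorem exists_isBasis_of_level (n : ℕ) {N : ℤ} {I : Type (max v w)} [Fintype I] {v : I → V}
    (F : GrFrame Λ P N v) (hF : ∀ i j, F.f i (F.p j) ∈ Λ.level n n) :
    ∃ (N' : ℤ) (J : Type (max v w)) (_ : Fintype J) (w : J → V) (B : GrFrame Λ P N' w),
      B.IsBasis := by
  induction n generalizing N I with
  | zero =>
    obtain ⟨J, _, a, hB⟩ := F.exists_isBasis_of_level_zero hF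
    exact ⟨N, J, _, _, hB⟩
  | succ n ih => exact ih F.refine (refine_level hF)

end Elimination

end GrFrame

theorem GrProjModule.exists_isBasis [GradedRing 𝒜] (Λ : LeavittFamily G 𝒜) (P : GrProjModule 𝒜) :
    ∃ (N : ℤ) (I : Type (max v w)) (_ : Fintype I) (v : I → V) (B : GrFrame Λ P N v),
      B.IsBasis := by
  obtain ⟨N, I, _, v, ⟨F⟩⟩ := exists_grFrame Λ P
  obtain ⟨n, hn⟩ := (F.eventually_level F).exists
  exact F.exists_isBasis_of_level n hn

end Bases

section Dimension

open Matrix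

theorem card_fiber_eq_sum_single {V I : Type*} [DecidableEq V] [Fintype I] (v : I → V) (u : V) :
    Fintype.card {i // v i = u} = (∑ i, Pi.single (v i) 1 : V → ℕ) u := by
  simp only [Fintype.card_subtype, Finset.card_filter, Finset.sum_apply, Pi.single_apply, eq_comm]

theorem exists_sigma_fin_equiv {V I : Type*} [DecidableEq V] [Fintype I] {v : I → V} {a : V → ℕ}
    (h : ∑ i, Pi.single (v i) 1 = a) : ∃ e : (Σ u, Fin (a u)) ≃ I, ∀ j, v (e j) = j.1 := by
  subst h
  let e (u : V) : Fin ((∑ i, Pi.single (v i) 1 : V → ℕ) u) ≃ {i // v i = u} :=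
    (Fintype.equivFinOfCardEq (card_fiber_eq_sum_single v u)).symm
  exact ⟨(Equiv.sigmaCongrRight e).trans (Equiv.sigmaFiberEquiv v), fun j => (e j.1 j.2).2⟩

theorem sum_sigma_fin_single {V : Type*} [Fintype V] [DecidableEq V] (a : V → ℕ) :
    ∑ i : Σ u, Fin (a u), Pi.single i.1 1 = a := by
  rw [Fintype.sum_sigma]
  simpa [Finset.sum_const, ← Pi.single_smul] using Finset.univ_sum_single a

theorem DirectedGraph.sum_single_r {V E : Type*} [Fintype E] [DecidableEq V]
    (G : DirectedGraph V E) (u : V) :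
    ∑ e : {e // G.s e = u}, Pi.single (G.r e) 1 = G.adjMatrix u := by
  funext w
  rw [← card_fiber_eq_sum_single, DirectedGraph.adjMatrix, ← Fintype.card_subtype]
  exact Fintype.card_congr (Equiv.subtypeSubtypeEquivSubtypeInter _ fun e => G.r e = w)

theorem DirectedGraph.sum_single_refine {V E I : Type*} [Fintype V] [Fintype E] [DecidableEq V]
    (G : DirectedGraph V E) [Fintype I] (v : I → V) :
    ∑ i : Σ i, {e // G.s e = v i}, Pi.single (G.r i.2) 1 =
      (∑ i, Pi.single (v i) 1) ᵥ* G.adjMatrix := by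
  rw [Fintype.sum_sigma, Matrix.sum_vecMul]
  simp only [G.sum_single_r, single_one_vecMul, Matrix.row_def]

variable {K : Type*} [Field K] {V : Type v} {E : Type w} [Fintype V] [Fintype E] [DecidableEq V]
  {G : DirectedGraph V E} {L : Type u} [Ring L] [Algebra K L] {𝒜 : ℤ → Submodule K L}

/-- `P` has a basis of degree `N` with `a u` elements at each vertex `u`. -/
def HasDimension (Λ : LeavittFamily G 𝒜) (P : GrProjModule 𝒜) (N : ℤ) (a : V → ℕ) : Prop :=
  ∃ F : GrFrame Λ P N (fun i : Σ u, Fin (a u) => i.1), F.IsBasis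

namespace HasDimension

variable {Λ : LeavittFamily G 𝒜} {P Q : GrProjModule 𝒜} {N : ℤ} {a b : V → ℕ}

theorem of_isBasis {I : Type*} [Fintype I] {v : I → V} {F : GrFrame Λ P N v} (hF : F.IsBasis)
    (h : ∑ i, Pi.single (v i) 1 = a) : HasDimension Λ P N a := by
  obtain ⟨e, he⟩ := exists_sigma_fin_equiv h
  exact ⟨F.reindex e he, hF.reindex e he⟩

theorem grIso (hP : HasDimension Λ P N a) (hQ : HasDimension Λ Q N a) :
    GrProjModule.GrIso P Q := by
  obtain ⟨F, hF⟩ := hP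
  obtain ⟨B, hB⟩ := hQ
  exact hF.grIso hB

theorem of_grIso (hP : HasDimension Λ P N a) (h : GrProjModule.GrIso P Q) :
    HasDimension Λ Q N a := by
  obtain ⟨F, hF⟩ := hP
  obtain ⟨φ, hφ⟩ := h
  exact ⟨F.map φ hφ, hF.map φ hφ⟩

theorem prod (hP : HasDimension Λ P N a) (hQ : HasDimension Λ Q N b) :
    HasDimension Λ (P.prod Q) N (a + b) := by
  obtain ⟨F, hF⟩ := hP
  obtain ⟨B, hB⟩ := hQ
  exact of_isBasis (hF.prod hB) <| (Fintype.sum_sum_type _).trans <|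
    congrArg₂ _ (sum_sigma_fin_single a) (sum_sigma_fin_single b)

theorem shift (hP : HasDimension Λ P N a) (k : ℤ) : HasDimension Λ (P.shift k) (N - k) a := by
  obtain ⟨F, hF⟩ := hP
  exact ⟨F.shift k, hF.shift k⟩

variable (Λ) in
theorem zero : HasDimension Λ (GrProjModule.zero (𝒜 := 𝒜)) 0 0 := by
  have : IsEmpty (Σ u : V, Fin ((0 : V → ℕ) u)) := ⟨fun i => i.2.elim0⟩
  exact ⟨⟨isEmptyElim, isEmptyElim, isEmptyElim, isEmptyElim, isEmptyElim, isEmptyElim,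
    fun _ => rfl⟩, ⟨isEmptyElim, isEmptyElim⟩⟩

theorem vecMul_pow_eq_of_level [SetLike.GradedMonoid 𝒜] (n : ℕ) {N : ℤ} {a b : V → ℕ}
    {F : GrFrame Λ P N fun i : Σ u, Fin (a u) => i.1}
    {B : GrFrame Λ P N fun i : Σ u, Fin (b u) => i.1} (hF : F.IsBasis) (hB : B.IsBasis)
    (hFB : ∀ i j, F.f i (B.p j) ∈ Λ.level n n) (hBF : ∀ j i, B.f j (F.p i) ∈ Λ.level n n) :
    a ᵥ* G.adjMatrix ^ n = b ᵥ* G.adjMatrix ^ n := by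
  induction n generalizing N a b with
  | zero =>
    have h (u : V) :=
      (hF.card_le_of_level_zero B hBF u).antisymm (hB.card_le_of_level_zero F hFB u)
    simp only [card_fiber_eq_sum_single, sum_sigma_fin_single] at h
    rw [funext h]
  | succ n ih =>
    obtain ⟨e, he⟩ := exists_sigma_fin_equiv (G.sum_single_refine fun i : Σ u, Fin (a u) => i.1)
    obtain ⟨e', he'⟩ := exists_sigma_fin_equiv (G.sum_single_refine fun i : Σ u, Fin (b u) => i.1)
    have h := ih (hF.refine.reindex e he) (hB.refine.reindex e' he')
      (fun i j => GrFrame.refine_level hFB (e i) (e' j))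
      fun j i => GrFrame.refine_level hBF (e' j) (e i)
    simpa only [sum_sigma_fin_single, vecMul_vecMul, ← pow_succ'] using h

theorem exists_vecMul_pow_eq [SetLike.GradedMonoid 𝒜] (ha : HasDimension Λ P N a)
    (hb : HasDimension Λ P N b) : ∃ n, a ᵥ* G.adjMatrix ^ n = b ᵥ* G.adjMatrix ^ n := by
  obtain ⟨F, hF⟩ := ha
  obtain ⟨B, hB⟩ := hb
  obtain ⟨n, hFB, hBF⟩ := ((F.eventually_level B).and (B.eventually_level F)).exists
  exact ⟨n, vecMul_pow_eq_of_level n hF hB hFB hBF⟩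

theorem refine [SetLike.GradedMonoid 𝒜] (hP : HasDimension Λ P N a) :
    HasDimension Λ P (N + 1) (a ᵥ* G.adjMatrix) := by
  obtain ⟨F, hF⟩ := hP
  exact of_isBasis hF.refine (by rw [G.sum_single_refine, sum_sigma_fin_single])

theorem refine_iterate [SetLike.GradedMonoid 𝒜] (hP : HasDimension Λ P N a) (n : ℕ) :
    HasDimension Λ P (N + n) (a ᵥ* G.adjMatrix ^ n) := by
  induction n with
  | zero => simpa using hP
  | succ n ih => simpa [add_assoc, vecMul_vecMul, ← pow_succ] using ih.refine

end HasDimension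

theorem exists_hasDimension [GradedRing 𝒜] (Λ : LeavittFamily G 𝒜) (P : GrProjModule 𝒜) :
    ∃ N a, HasDimension Λ P N a := by
  obtain ⟨N, I, _, v, B, hB⟩ := P.exists_isBasis Λ
  exact ⟨N, _, .of_isBasis hB rfl⟩

namespace LeavittFamily

variable [GradedRing 𝒜] (Λ : LeavittFamily G 𝒜)

/-- The right ideal generated by a vertex, as a graded projective module. -/
noncomputable def vtxModule (v : V) : GrProjModule 𝒜 :=
  .ofIdempotent (Λ.vtx_mul_self v) (Λ.vtx_mem v)

theorem hasDimension_vtxModule (v : V) : HasDimension Λ (Λ.vtxModule v) 0 (Pi.single v 1) := by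
  let M : Submodule Lᵐᵒᵖ L := LinearMap.eqLocus (LinearMap.mulLeft Lᵐᵒᵖ (Λ.vtx v)) LinearMap.id
  let F : GrFrame Λ (Λ.vtxModule v) 0 (fun _ : Unit => v) :=
    { p := fun _ => (⟨Λ.vtx v, Λ.vtx_mul_self v⟩ : M)
      f := fun _ => M.subtype
      p_mem := fun _ => Λ.vtx_mem v
      f_mem := fun _ k _ hx => by
        rw [sub_zero]
        exact hx
      p_vtx := fun _ => Subtype.ext (Λ.vtx_mul_self v)
      vtx_f := fun _ x => x.2
      sum_eq := fun x => (Fintype.sum_unique _).trans (Subtype.ext x.2) }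
  have hF : F.IsBasis := ⟨fun _ => rfl, fun _ _ h => absurd rfl h⟩
  exact .of_isBasis hF (Fintype.sum_unique _)

end LeavittFamily

end Dimension

theorem pow_mul_eq_mul_pow {V W α : Type*} [Fintype V] [DecidableEq V] [Fintype W] [DecidableEq W]
    [Semiring α] {A : Matrix V V α} {B : Matrix W W α} {R : Matrix V W α} (h : A * R = R * B)
    (n : ℕ) : A ^ n * R = R * B ^ n := by
  induction n with
  | zero => rw [pow_zero, pow_zero, Matrix.one_mul, Matrix.mul_one]
  | succ n ih => rw [pow_succ, Matrix.mul_assoc, h, ← Matrix.mul_assoc, ih, Matrix.mul_assoc,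
      pow_succ]

section DimensionModule

open LaurentPolynomial (T isUnit_T T_add T_zero)
open Fintype (linearCombination)
open Matrix

variable {U V W : Type*} [Fintype U] [Fintype V] [Fintype W]
  {L M N : Type*} [AddCommGroup L] [Module ℤ[T;T⁻¹] L] [AddCommGroup M] [Module ℤ[T;T⁻¹] M]
  [AddCommGroup N] [Module ℤ[T;T⁻¹] N]
  {A : Matrix V V ℕ} {x : V → M} {B : Matrix W W ℕ} {y : W → N} {w : U → L}

theorem map_linearCombination {M N : Type*} [AddCommMonoid M] [AddCommMonoid N] (f : M →+ N)
    (x : V → M) (a : V → ℕ) :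
    f (linearCombination ℕ x a) = linearCombination ℕ (fun v => f (x v)) a := by
  simp only [Fintype.linearCombination_apply, map_sum, map_nsmul]

theorem linearCombination_vecMul {M : Type*} [AddCommMonoid M] (y : W → M) (a : V → ℕ)
    (R : Matrix V W ℕ) :
    linearCombination ℕ y (a ᵥ* R) =
      linearCombination ℕ (fun v => linearCombination ℕ y (R v)) a := by
  simp only [Matrix.vecMul_eq_sum, map_sum, map_smul, Fintype.linearCombination_apply]

theorem T_smul_linearCombination (n : ℤ) (x : V → M) (a : V → ℕ) :
    (T n : ℤ[T;T⁻¹]) • linearCombination ℕ x a =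
      linearCombination ℕ (fun v => (T n : ℤ[T;T⁻¹]) • x v) a :=
  map_linearCombination (DistribSMul.toAddMonoidHom M (T n : ℤ[T;T⁻¹])) x a

/-- The variable `T` acts on the family `x` through the matrix `A`. -/
def TransformsBy (A : Matrix V V ℕ) (x : V → M) : Prop :=
  ∀ v, (T 1 : ℤ[T;T⁻¹]) • x v = linearCombination ℕ x (A v)

theorem TransformsBy.T_smul [DecidableEq V] (hx : TransformsBy A x) (n : ℕ) (a : V → ℕ) :
    (T n : ℤ[T;T⁻¹]) • linearCombination ℕ x a = linearCombination ℕ x (a ᵥ* A ^ n) := by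
  induction n generalizing a with
  | zero => simp
  | succ n ih =>
    rw [Nat.cast_succ, T_add, mul_smul, T_smul_linearCombination, funext hx,
      ← linearCombination_vecMul, ih, vecMul_vecMul, ← pow_succ']

theorem TransformsBy.eventually_T_smul_mem_span (hx : TransformsBy A x) {z : M}
    (hz : z ∈ Submodule.span ℤ[T;T⁻¹] (Set.range x)) :
    ∀ᶠ n : ℕ in atTop, (T n : ℤ[T;T⁻¹]) • z ∈ Submodule.span ℤ (Set.range x) := by
  classical
  induction hz using Submodule.closure_induction with
  | zero => exact .of_forall fun n => by simp only [smul_zero, zero_mem]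
  | add z₁ z₂ _ _ h₁ h₂ =>
    filter_upwards [h₁, h₂] with n h₁ h₂
    rw [smul_add]
    exact add_mem h₁ h₂
  | smul_mem r z hz =>
    obtain ⟨v, rfl⟩ := hz
    induction r using LaurentPolynomial.induction_on' with
    | add p q hp hq =>
      filter_upwards [hp, hq] with n hp hq
      rw [add_smul, smul_add]
      exact add_mem hp hq
    | C_mul_T k c =>
      filter_upwards [eventually_ge_atTop (-k).toNat] with n hn
      obtain ⟨m, hm⟩ := Int.eq_ofNat_of_zero_le (show 0 ≤ k + n by omega)
      have h := hx.T_smul m (Pi.single v 1)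
      rw [Fintype.linearCombination_apply_single, one_smul] at h
      rw [smul_smul, mul_left_comm, mul_comm (T _), ← T_add, hm, mul_smul, eq_intCast,
        Int.cast_smul_eq_zsmul, h]
      refine zsmul_mem (sum_mem fun w _ => nsmul_mem ?_ _) c
      exact Submodule.subset_span (Set.mem_range_self w)

theorem TransformsBy.exists_T_smul_eq_sub (hx : TransformsBy A x) {z : M}
    (hz : z ∈ Submodule.span ℤ[T;T⁻¹] (Set.range x)) : ∃ (n : ℕ) (a b : V → ℕ),
      (T n : ℤ[T;T⁻¹]) • z = linearCombination ℕ x a - linearCombination ℕ x b := by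
  obtain ⟨n, hn⟩ := (hx.eventually_T_smul_mem_span hz).exists
  obtain ⟨c, hc⟩ := (Submodule.mem_span_range_iff_exists_fun ℤ).1 hn
  refine ⟨n, fun v => (c v).toNat, fun v => (-c v).toNat, ?_⟩
  simp only [← hc, Fintype.linearCombination_apply, ← Finset.sum_sub_distrib, ← natCast_zsmul,
    ← sub_smul, Int.toNat_sub_toNat_neg]

/-- The module `M` with positive cone `C` is the dimension module of the matrix `A`: it is generated
by a family `x` on which `T` acts through `A`, its positive elements are those which some power of
`T` turns into nonnegative combinations of `x`, and two such combinations agree only if their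
coefficients become equal under a power of `A`. -/
structure IsDimensionModule [DecidableEq V] (A : Matrix V V ℕ) (C : AddSubmonoid M)
    (x : V → M) : Prop where
  transformsBy : TransformsBy A x
  span_eq_top : Submodule.span ℤ[T;T⁻¹] (Set.range x) = ⊤
  mem_iff : ∀ {z}, z ∈ C ↔ ∃ (n : ℕ) (a : V → ℕ), (T n : ℤ[T;T⁻¹]) • z = linearCombination ℕ x a
  exists_pow : ∀ {a b : V → ℕ}, linearCombination ℕ x a = linearCombination ℕ x b →
    ∃ n : ℕ, a ᵥ* A ^ n = b ᵥ* A ^ n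

/-- Up to the power `T ^ n`, the linear map `f` acts on the families `x` and `y` through the matrix
`R`. -/
def RepresentedBy (x : V → M) (y : W → N) (f : M →ₗ[ℤ[T;T⁻¹]] N) (n : ℕ) (R : Matrix V W ℕ) :
    Prop :=
  ∀ a, (T n : ℤ[T;T⁻¹]) • f (linearCombination ℕ x a) = linearCombination ℕ y (a ᵥ* R)

namespace RepresentedBy

variable {f g : M →ₗ[ℤ[T;T⁻¹]] N} {n : ℕ} {R R' : Matrix V W ℕ}

theorem of_forall (h : ∀ v, (T n : ℤ[T;T⁻¹]) • f (x v) = linearCombination ℕ y (R v)) :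
    RepresentedBy x y f n R := fun a => by
  have hf := map_linearCombination f.toAddMonoidHom x a
  rw [LinearMap.toAddMonoidHom_coe] at hf
  rw [hf, T_smul_linearCombination, funext h, linearCombination_vecMul]

theorem comp {g : N →ₗ[ℤ[T;T⁻¹]] L} {m : ℕ} {S : Matrix W U ℕ} (hg : RepresentedBy y w g m S)
    (hf : RepresentedBy x y f n R) : RepresentedBy x w (g ∘ₗ f) (n + m) (R * S) := fun a => by
  rw [Nat.cast_add, add_comm, T_add, mul_smul, LinearMap.comp_apply, ← map_smul g, hf, hg,
    vecMul_vecMul]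

theorem apply (hf : RepresentedBy x y f n R) (v : V) :
    (T n : ℤ[T;T⁻¹]) • f (x v) = linearCombination ℕ y (R v) := by
  classical
  have h := hf (Pi.single v 1)
  rwa [Fintype.linearCombination_apply_single, one_smul, single_one_vecMul, row_def] at h

theorem linearMap_ext (hf : RepresentedBy x y f n R) (hg : RepresentedBy x y g n R)
    (hx : Submodule.span ℤ[T;T⁻¹] (Set.range x) = ⊤) : f = g :=
  LinearMap.ext_on_range hx fun v =>
    (isUnit_T n).smul_left_cancel.1 ((hf.apply v).trans (hg.apply v).symm)

theorem eventually_mul_pow_eq [DecidableEq W] {D : AddSubmonoid N} (hy : IsDimensionModule B D y)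
    (h : RepresentedBy x y f n R) (h' : RepresentedBy x y f n R') :
    ∀ᶠ k in atTop, R * B ^ k = R' * B ^ k := by
  have hv (v : V) : ∀ᶠ k in atTop, R v ᵥ* B ^ k = R' v ᵥ* B ^ k := by
    obtain ⟨m, hm⟩ := hy.exists_pow ((h.apply v).symm.trans (h'.apply v))
    filter_upwards [eventually_ge_atTop m] with k hk
    rw [← Nat.add_sub_cancel' hk, pow_add, ← vecMul_vecMul, ← vecMul_vecMul, hm]
  filter_upwards [eventually_all.2 hv] with k hk
  exact funext hk

end RepresentedBy

variable [DecidableEq V] {C : AddSubmonoid M} {D : AddSubmonoid N}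

theorem TransformsBy.representedBy_id (hx : TransformsBy A x) (n : ℕ) :
    RepresentedBy x x LinearMap.id n (A ^ n) := hx.T_smul n

theorem TransformsBy.representedBy_T (hx : TransformsBy A x) (n : ℕ) :
    RepresentedBy x x ((T n : ℤ[T;T⁻¹]) • LinearMap.id) 0 (A ^ n) := fun a => by
  rw [Nat.cast_zero, T_zero, one_smul]
  exact hx.T_smul n a

namespace IsDimensionModule

variable (hM : IsDimensionModule A C x)
include hM

theorem T_smul_mem_iff {n : ℕ} {z : M} : (T n : ℤ[T;T⁻¹]) • z ∈ C ↔ z ∈ C := by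
  rw [hM.mem_iff, hM.mem_iff]
  constructor
  · rintro ⟨m, a, h⟩
    exact ⟨m + n, a, by rw [Nat.cast_add, T_add, mul_smul, h]⟩
  · rintro ⟨m, a, h⟩
    exact ⟨m, _, by rw [smul_comm, h, hM.transformsBy.T_smul]⟩

theorem exists_linearMap {x' : V → N} (hx' : TransformsBy A x') :
    ∃ f : M →ₗ[ℤ[T;T⁻¹]] N, ∀ v, f (x v) = x' v := by
  -- The span of the pairs `(x v, x' v)` is the graph of the required map.
  let p : V → M × N := fun v => (x v, x' v)
  let Γ := Submodule.span ℤ[T;T⁻¹] (Set.range p)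
  have hlc (a : V → ℕ) :
      linearCombination ℕ p a = (linearCombination ℕ x a, linearCombination ℕ x' a) :=
    Prod.ext (map_linearCombination (.fst M N) p a) (map_linearCombination (.snd M N) p a)
  have hp : TransformsBy A p := fun v => by
    rw [hlc, ← hM.transformsBy, ← hx']
    rfl
  have h_snd (z : M × N) (hz : z ∈ Γ) (h : z.1 = 0) : z.2 = 0 := by
    obtain ⟨n, a, b, hab⟩ := hp.exists_T_smul_eq_sub hz
    rw [hlc, hlc, Prod.mk_sub_mk, Prod.ext_iff, Prod.smul_fst, Prod.smul_snd, h, smul_zero] at hab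
    obtain ⟨m, hm⟩ := hM.exists_pow (sub_eq_zero.1 hab.1.symm)
    rw [← (isUnit_T (R := ℤ) n).smul_eq_zero, ← (isUnit_T (R := ℤ) m).smul_eq_zero, hab.2, smul_sub,
      hx'.T_smul, hx'.T_smul, hm, sub_self]
  let π : Γ →ₗ[ℤ[T;T⁻¹]] M := LinearMap.fst ℤ[T;T⁻¹] M N ∘ₗ Γ.subtype
  have h_inj : Function.Injective π := (injective_iff_map_eq_zero π).2 fun z hz =>
    Subtype.ext (Prod.ext hz (h_snd z z.2 hz))
  have h_surj : Function.Surjective π := by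
    rw [← LinearMap.range_eq_top, LinearMap.range_comp, Submodule.range_subtype, Submodule.map_span,
      ← Set.range_comp]
    exact hM.span_eq_top
  obtain ⟨f, hf⟩ := Submodule.exists_eq_graph (G := Γ) ⟨h_inj, h_surj⟩
  have h_mem (v : V) : p v ∈ f.graph := hf ▸ Submodule.subset_span (Set.mem_range_self v)
  exact ⟨f, fun v => ((LinearMap.mem_graph_iff f (p v)).1 (h_mem v)).symm⟩

theorem eventually_mul_mul_pow {f : M →ₗ[ℤ[T;T⁻¹]] N} {g : N →ₗ[ℤ[T;T⁻¹]] M}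
    (hgf : g ∘ₗ f = LinearMap.id) {n m : ℕ} {R : Matrix V W ℕ} {S : Matrix W V ℕ}
    (hf : RepresentedBy x y f n R) (hg : RepresentedBy y x g m S) :
    ∀ᶠ k in atTop, R * S * A ^ k = A ^ (n + m + k) := by
  simp only [pow_add _ (n + m)]
  exact (hgf ▸ hg.comp hf).eventually_mul_pow_eq hM (hM.transformsBy.representedBy_id (n + m))

variable [DecidableEq W] (hN : IsDimensionModule B D y)
include hN

theorem map_mem {f : M →ₗ[ℤ[T;T⁻¹]] N} {n : ℕ} {R : Matrix V W ℕ} (hf : RepresentedBy x y f n R)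
    {z : M} (hz : z ∈ C) : f z ∈ D := by
  obtain ⟨m, a, h⟩ := hM.mem_iff.1 hz
  refine hN.mem_iff.2 ⟨n + m, a ᵥ* R, ?_⟩
  rw [Nat.cast_add, T_add, mul_smul, ← map_smul, h, hf]

theorem exists_representedBy {R : Matrix V W ℕ} (hR : A * R = R * B) :
    ∃ f : M →ₗ[ℤ[T;T⁻¹]] N, RepresentedBy x y f 0 R := by
  have hyR : TransformsBy A fun v => linearCombination ℕ y (R v) := fun v => by
    have h := hN.transformsBy.T_smul 1 (R v)
    rw [Nat.cast_one, pow_one] at h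
    rw [h, ← linearCombination_vecMul]
    exact congrArg _ (congrFun hR v).symm
  obtain ⟨f, hf⟩ := hM.exists_linearMap hyR
  exact ⟨f, .of_forall fun v => by rw [Nat.cast_zero, T_zero, one_smul, hf]⟩

theorem exists_equiv_of_shiftEquivalent (h : Matrix.ShiftEquivalent A B) :
    ∃ φ : M ≃ₗ[ℤ[T;T⁻¹]] N, ∀ z, φ z ∈ D ↔ z ∈ C := by
  obtain ⟨l, R, S, -, hA, hB, hR, hS⟩ := h
  obtain ⟨f, hf⟩ := hM.exists_representedBy hN hR
  obtain ⟨g, hg⟩ := hN.exists_representedBy hM hS.symm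
  have hgf : g ∘ₗ f = (T l : ℤ[T;T⁻¹]) • LinearMap.id :=
    (hg.comp hf).linearMap_ext (hA ▸ hM.transformsBy.representedBy_T l) hM.span_eq_top
  have hfg : f ∘ₗ g = (T l : ℤ[T;T⁻¹]) • LinearMap.id :=
    (hf.comp hg).linearMap_ext (hB ▸ hN.transformsBy.representedBy_T l) hN.span_eq_top
  have hT : (T (-l) * T l : ℤ[T;T⁻¹]) = 1 := by rw [← T_add, neg_add_cancel, T_zero]
  let φ : M ≃ₗ[ℤ[T;T⁻¹]] N := LinearEquiv.ofLinearMap f ((T (-l) : ℤ[T;T⁻¹]) • g)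
    (by rw [LinearMap.comp_smul, hfg, smul_smul, hT, one_smul])
    (by rw [LinearMap.smul_comp, hgf, smul_smul, hT, one_smul])
  refine ⟨φ, fun z => ⟨fun hz => ?_, hM.map_mem hN hf⟩⟩
  have h : g (f z) = (T l : ℤ[T;T⁻¹]) • z := LinearMap.congr_fun hgf z
  rw [← hM.T_smul_mem_iff (n := l), ← h]
  exact hN.map_mem hM hg hz

theorem exists_matrix {f : M →ₗ[ℤ[T;T⁻¹]] N} (hf : ∀ z ∈ C, f z ∈ D) :
    ∃ (n : ℕ) (R : Matrix V W ℕ), A * R = R * B ∧ RepresentedBy x y f n R := by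
  have h_mem (v : V) : ∀ᶠ n : ℕ in atTop,
      ∃ a, (T n : ℤ[T;T⁻¹]) • f (x v) = linearCombination ℕ y a := by
    have hx : x v ∈ C := hM.mem_iff.2 ⟨0, Pi.single v 1, by simp⟩
    obtain ⟨m, a, h⟩ := hN.mem_iff.1 (hf _ hx)
    filter_upwards [eventually_ge_atTop m] with n hn
    refine ⟨a ᵥ* B ^ (n - m), ?_⟩
    rw [← hN.transformsBy.T_smul, ← h, smul_smul, ← T_add, ← Nat.cast_add, Nat.sub_add_cancel hn]
  obtain ⟨n, hn⟩ := (eventually_all.2 h_mem).exists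
  obtain ⟨R, hR⟩ : ∃ R : Matrix V W ℕ, ∀ v, _ := Classical.skolem.1 hn
  have hfR : RepresentedBy x y f n R := .of_forall hR
  have hAR := hfR.comp (hM.transformsBy.representedBy_T 1)
  have hRB := (hN.transformsBy.representedBy_T 1).comp hfR
  rw [LinearMap.comp_smul, LinearMap.comp_id, zero_add, pow_one] at hAR
  rw [LinearMap.smul_comp, LinearMap.id_comp, add_zero, pow_one] at hRB
  obtain ⟨k, hk⟩ := (hAR.eventually_mul_pow_eq hN hRB).exists
  refine ⟨n + k, R * B ^ k, ?_, (hN.transformsBy.representedBy_id k).comp hfR⟩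
  rw [← Matrix.mul_assoc, hk, Matrix.mul_assoc, Matrix.mul_assoc, pow_mul_comm']

theorem shiftEquivalent_of_equiv (φ : M ≃ₗ[ℤ[T;T⁻¹]] N) (hφ : ∀ z, φ z ∈ D ↔ z ∈ C) :
    Matrix.ShiftEquivalent A B := by
  obtain ⟨n, R, hR, hφR⟩ := hM.exists_matrix hN (f := φ.toLinearMap) fun z => (hφ z).2
  obtain ⟨m, S, hS, hφS⟩ := hN.exists_matrix hM (f := φ.symm.toLinearMap) fun z hz =>
    (hφ _).1 (by rwa [LinearEquiv.coe_coe, φ.apply_symm_apply])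
  obtain ⟨k, hk, hA, hB⟩ := ((eventually_ge_atTop 1).and
    ((hM.eventually_mul_mul_pow φ.symm_comp hφR hφS).and
      (hN.eventually_mul_mul_pow φ.comp_symm hφS hφR))).exists
  refine ⟨n + m + k, R, S * A ^ k, by omega, ?_, ?_, hR, ?_⟩
  · rw [← hA, Matrix.mul_assoc]
  · rw [Matrix.mul_assoc, pow_mul_eq_mul_pow hR, ← Matrix.mul_assoc, hB, add_comm m n]
  · rw [← Matrix.mul_assoc B, hS, Matrix.mul_assoc, Matrix.mul_assoc, pow_mul_comm']

end IsDimensionModule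

end DimensionModule

section Classes

open LaurentPolynomial (T isUnit_T T_add T_zero)
open Fintype (linearCombination)
open Matrix

theorem K0gr.of_mk_eq_iff {A : Type u} [Ring A] {σ : Type v} [SetLike σ A] {𝒜 : ℤ → σ}
    {P Q : GrProjModule 𝒜} : K0gr.of 𝒜 (Vgr.mk P) = K0gr.of 𝒜 (Vgr.mk Q) ↔
      ∃ R : GrProjModule 𝒜, GrProjModule.GrIso (R.prod P) (R.prod Q) := by
  refine (AddLocalization.addMonoidOf (⊤ : AddSubmonoid (Vgr 𝒜))).eq_iff_exists.trans ⟨?_, ?_⟩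
  · rintro ⟨⟨⟨R⟩, _⟩, hR⟩
    exact ⟨R, Quotient.exact hR⟩
  · rintro ⟨R, hR⟩
    exact ⟨⟨Vgr.mk R, trivial⟩, Quotient.sound hR⟩

theorem K0gr.exists_eq_sub {A : Type u} [Ring A] {σ : Type v} [SetLike σ A] {𝒜 : ℤ → σ}
    (z : K0gr 𝒜) : ∃ P Q : GrProjModule 𝒜, z = K0gr.of 𝒜 (Vgr.mk P) - K0gr.of 𝒜 (Vgr.mk Q) := by
  obtain ⟨⟨⟨P⟩, ⟨⟨Q⟩, _⟩⟩, h⟩ := (AddLocalization.addMonoidOf (⊤ : AddSubmonoid (Vgr 𝒜))).surj z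
  exact ⟨P, Q, eq_sub_of_add_eq h⟩

namespace LeavittFamily

variable {K : Type*} [Field K] {V : Type v} {E : Type w} [Fintype V] [Fintype E] [DecidableEq V]
  {G : DirectedGraph V E} {L : Type u} [Ring L] [Algebra K L] {𝒜 : ℤ → Submodule K L}
  [GradedRing 𝒜] (Λ : LeavittFamily G 𝒜)

theorem exists_hasDimension_zero (a : V → ℕ) : ∃ P : GrProjModule 𝒜, HasDimension Λ P 0 a ∧
    Vgr.mk P = linearCombination ℕ (fun v => Vgr.mk (Λ.vtxModule v)) a := by
  let f := linearCombination ℕ fun v => Vgr.mk (Λ.vtxModule v)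
  let S : AddSubmonoid (V → ℕ) :=
    { carrier := {a | ∃ P : GrProjModule 𝒜, HasDimension Λ P 0 a ∧ Vgr.mk P = f a}
      zero_mem' := ⟨.zero, .zero Λ, (map_zero f).symm⟩
      add_mem' := by
        rintro a b ⟨P, hP, hPa⟩ ⟨Q, hQ, hQb⟩
        refine ⟨P.prod Q, hP.prod hQ, ?_⟩
        rw [map_add, ← hPa, ← hQb]
        rfl }
  have h_single (v : V) : Pi.single v 1 ∈ S := by
    refine ⟨Λ.vtxModule v, Λ.hasDimension_vtxModule v, ?_⟩
    rw [Fintype.linearCombination_apply_single, one_smul]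
  have ha : ∑ v, a v • Pi.single v 1 = a := by
    simp only [← Pi.single_smul, smul_eq_mul, mul_one, Finset.univ_sum_single]
  exact ha ▸ S.sum_mem fun v _ => S.nsmul_mem (h_single v) (a v)

/-- The class of the module generated by a vertex. -/
noncomputable def vtxClass (v : V) : K0gr 𝒜 := K0gr.of 𝒜 (Vgr.mk (Λ.vtxModule v))

theorem of_mk_eq_of_hasDimension {P : GrProjModule 𝒜} {a : V → ℕ} (hP : HasDimension Λ P 0 a) :
    K0gr.of 𝒜 (Vgr.mk P) = linearCombination ℕ Λ.vtxClass a := by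
  obtain ⟨Q, hQ, hQa⟩ := Λ.exists_hasDimension_zero a
  have hPQ : Vgr.mk P = Vgr.mk Q := Quotient.sound (hP.grIso hQ)
  rw [hPQ, hQa, map_linearCombination]
  rfl

theorem transformsBy_vtxClass : TransformsBy G.adjMatrix Λ.vtxClass := fun v => by
  have h := (Λ.hasDimension_vtxModule v).refine.shift 1
  rw [zero_add, sub_self, single_one_vecMul, row_def] at h
  rw [vtxClass, K0gr.T_smul_of_mk, Λ.of_mk_eq_of_hasDimension h]

theorem exists_T_smul_of_mk_eq (P : GrProjModule 𝒜) : ∃ (n : ℕ) (a : V → ℕ),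
    (T n : ℤ[T;T⁻¹]) • K0gr.of 𝒜 (Vgr.mk P) = linearCombination ℕ Λ.vtxClass a := by
  obtain ⟨N, a, hP⟩ := exists_hasDimension Λ P
  have h := (hP.refine_iterate (-N).toNat).shift N.toNat
  rw [show N + ((-N).toNat : ℤ) - N.toNat = 0 by omega] at h
  exact ⟨N.toNat, _, (K0gr.T_smul_of_mk ..).trans (Λ.of_mk_eq_of_hasDimension h)⟩

theorem mem_mrange_of_iff {z : K0gr 𝒜} : z ∈ AddMonoidHom.mrange (K0gr.of 𝒜) ↔
    ∃ (n : ℕ) (a : V → ℕ), (T n : ℤ[T;T⁻¹]) • z = linearCombination ℕ Λ.vtxClass a := by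
  constructor
  · rintro ⟨⟨P⟩, rfl⟩
    exact Λ.exists_T_smul_of_mk_eq P
  · rintro ⟨n, a, h⟩
    obtain ⟨P, hP, -⟩ := Λ.exists_hasDimension_zero a
    refine ⟨Vgr.mk (P.shift (-n)), ?_⟩
    rw [← K0gr.T_smul_of_mk, Λ.of_mk_eq_of_hasDimension hP, ← h, smul_smul, ← T_add, neg_add_cancel,
      T_zero, one_smul]

theorem exists_vecMul_pow_eq {a b : V → ℕ}
    (h : linearCombination ℕ Λ.vtxClass a = linearCombination ℕ Λ.vtxClass b) :
    ∃ n : ℕ, a ᵥ* G.adjMatrix ^ n = b ᵥ* G.adjMatrix ^ n := by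
  obtain ⟨P, hP, -⟩ := Λ.exists_hasDimension_zero a
  obtain ⟨Q, hQ, -⟩ := Λ.exists_hasDimension_zero b
  rw [← Λ.of_mk_eq_of_hasDimension hP, ← Λ.of_mk_eq_of_hasDimension hQ, K0gr.of_mk_eq_iff] at h
  obtain ⟨R, hR⟩ := h
  obtain ⟨N, c, hc⟩ := exists_hasDimension Λ R
  have hc' := hc.refine_iterate (-N).toNat
  have hP' := hP.refine_iterate N.toNat
  have hQ' := hQ.refine_iterate N.toNat
  rw [show 0 + (N.toNat : ℤ) = N + (-N).toNat by omega] at hP' hQ'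
  obtain ⟨n, hn⟩ := ((hc'.prod hP').of_grIso hR).exists_vecMul_pow_eq (hc'.prod hQ')
  rw [add_vecMul, add_vecMul, add_right_inj, vecMul_vecMul, vecMul_vecMul, ← pow_add] at hn
  exact ⟨N.toNat + n, hn⟩

theorem span_range_vtxClass : Submodule.span ℤ[T;T⁻¹] (Set.range Λ.vtxClass) = ⊤ := by
  have h_of (P : GrProjModule 𝒜) :
      K0gr.of 𝒜 (Vgr.mk P) ∈ Submodule.span ℤ[T;T⁻¹] (Set.range Λ.vtxClass) := by
    obtain ⟨n, a, h⟩ := Λ.exists_T_smul_of_mk_eq P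
    rw [← Submodule.smul_mem_iff_of_isUnit _ (isUnit_T n), h]
    exact sum_mem fun v _ => nsmul_mem (Submodule.subset_span (Set.mem_range_self v)) _
  refine eq_top_iff.2 fun z _ => ?_
  obtain ⟨P, Q, rfl⟩ := K0gr.exists_eq_sub z
  exact sub_mem (h_of P) (h_of Q)

theorem isDimensionModule :
    IsDimensionModule G.adjMatrix (AddMonoidHom.mrange (K0gr.of 𝒜)) Λ.vtxClass where
  transformsBy := Λ.transformsBy_vtxClass
  span_eq_top := Λ.span_range_vtxClass
  mem_iff := Λ.mem_mrange_of_iff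
  exists_pow := Λ.exists_vecMul_pow_eq

end LeavittFamily

end Classes

namespace DirectedGraph

section Representation

variable {V E : Type*} (G : DirectedGraph V E)

theorem exists_branching [Countable E] (hG : G.NoSinks) :
    ∃ Ψ : V × ℕ ≃ E × ℕ, ∀ x, G.s (Ψ x).1 = x.1 := by
  have h (v : V) : Nonempty (ℕ ≃ {e // G.s e = v} × ℕ) :=
    have : Nonempty {e // G.s e = v} := nonempty_subtype.2 (hG v)
    nonempty_equiv_of_countable
  let β (v : V) : ℕ ≃ {e // G.s e = v} × ℕ := (h v).some
  exact ⟨(Equiv.sigmaEquivProd V ℕ).symm.trans <| (Equiv.sigmaCongrRight β).trans <|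
    (Equiv.sigmaProdDistrib (fun v => {e // G.s e = v}) ℕ).symm.trans <|
      (Equiv.sigmaFiberEquiv G.s).prodCongr (Equiv.refl ℕ), fun x => (β x.1 x.2).1.2⟩

variable {G} (K : Type*) [Field K] (Ψ : V × ℕ ≃ E × ℕ) [DecidableEq V] [DecidableEq E]

/-- The action of the generators of the Leavitt path algebra on the functions on `V × ℕ` given by a
bijection `Ψ : V × ℕ ≃ E × ℕ` over the source map: it splits the copy of `ℕ` at each vertex into
copies of `ℕ` at the edges which the vertex emits, and the copy at an edge is identified with the
copy at its range. -/
def branchingAction : Gen V E → Module.End K (V × ℕ → K)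
  | .vertex v => .pi fun x => if x.1 = v then .proj x else 0
  | .edge e => .pi fun x => if (Ψ x).1 = e then .proj (G.r e, (Ψ x).2) else 0
  | .ghost e => .pi fun x => if x.1 = G.r e then .proj (Ψ.symm (e, x.2)) else 0

theorem branchingAction_vertex (v : V) (h : V × ℕ → K) (x : V × ℕ) :
    branchingAction (G := G) K Ψ (.vertex v) h x = if x.1 = v then h x else 0 := by
  simp only [branchingAction, LinearMap.pi_apply]
  split_ifs <;> rfl

theorem branchingAction_edge (e : E) (h : V × ℕ → K) (x : V × ℕ) :
    branchingAction (G := G) K Ψ (.edge e) h x =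
      if (Ψ x).1 = e then h (G.r e, (Ψ x).2) else 0 := by
  simp only [branchingAction, LinearMap.pi_apply]
  split_ifs <;> rfl

theorem branchingAction_ghost (e : E) (h : V × ℕ → K) (x : V × ℕ) :
    branchingAction (G := G) K Ψ (.ghost e) h x =
      if x.1 = G.r e then h (Ψ.symm (e, x.2)) else 0 := by
  simp only [branchingAction, LinearMap.pi_apply]
  split_ifs <;> rfl

variable [Fintype V] [Fintype E] {Ψ}

theorem branchingAction_rel (hΨ : ∀ x, G.s (Ψ x).1 = x.1) {a b : FreeAlgebra K (Gen V E)}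
    (h : G.LeavittRel K a b) : FreeAlgebra.lift K (branchingAction (G := G) K Ψ) a =
      FreeAlgebra.lift K (branchingAction (G := G) K Ψ) b := by
  have hΨ_symm : ∀ y, (Ψ.symm y).1 = G.s y.1 := fun y => by rw [← hΨ, Equiv.apply_symm_apply]
  refine LinearMap.ext fun k => funext fun x => ?_
  cases h <;>
    simp only [map_sum, map_mul, map_one, map_zero, FreeAlgebra.lift_ι_apply, Module.End.mul_apply,
      LinearMap.sum_apply, Finset.sum_apply, Module.End.one_apply, LinearMap.zero_apply,
      Pi.zero_apply, branchingAction_vertex, branchingAction_edge, branchingAction_ghost]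
  case one => simp
  case vertex_idem => split_ifs <;> rfl
  case vertex_orthogonal v w hvw =>
    split_ifs with hv hw
    · exact absurd (hv.symm.trans hw) hvw
    · rfl
    · rfl
  case s_edge e =>
    exact ite_eq_left_iff.2 fun hs => (if_neg fun he => hs (by rw [← hΨ, he])).symm
  case edge_r => simp
  case r_ghost => split_ifs <;> rfl
  case ghost_s e => simp [hΨ_symm]
  case ghost_edge e =>
    rw [Equiv.apply_symm_apply, if_pos rfl]
    split_ifs with hx
    · rw [← hx]
    · rfl
  case ghost_edge_ne e f hef => simp [hef]
  case sum_edge_ghost v hv =>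
    rw [Finset.sum_filter, Finset.sum_eq_single (Ψ x).1 (fun e _ he => by simp [he.symm]) (by simp)]
    simp [hΨ]

end Representation

variable {V : Type*} {E : Type*} [Fintype V] [Fintype E] [DecidableEq V]
  (G : DirectedGraph V E) (K : Type*) [Field K]

theorem gen_vertex_ne_zero (hG : G.NoSinks) (v : V) : G.gen K (.vertex v) ≠ 0 := by
  classical
  obtain ⟨Ψ, hΨ⟩ := G.exists_branching hG
  let ρ : G.LeavittPathAlgebra K →ₐ[K] Module.End K (V × ℕ → K) :=
    RingQuot.liftAlgHom K ⟨FreeAlgebra.lift K (branchingAction (G := G) K Ψ),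
      fun _ _ h => branchingAction_rel K hΨ h⟩
  have hρ : ρ (G.gen K (.vertex v)) = branchingAction (G := G) K Ψ (.vertex v) := by
    rw [gen, RingQuot.liftAlgHom_mkAlgHom_apply, FreeAlgebra.lift_ι_apply]
  intro h
  have h₁ : ρ (G.gen K (.vertex v)) (fun _ => 1) (v, 0) = 1 := by
    rw [hρ, branchingAction_vertex, if_pos rfl]
  rw [h, map_zero] at h₁
  exact zero_ne_one h₁

/-- The vertices, edges and ghost edges in the Leavitt path algebra of `G`. -/
noncomputable def leavittFamily (hG : G.NoSinks) : LeavittFamily G (G.leavittGrading K) where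
  vtx v := G.gen K (.vertex v)
  edge e := G.gen K (.edge e)
  ghost e := G.gen K (.ghost e)
  sum_vtx := by simpa [gen] using G.gen_rel K .one
  vtx_mul_vtx v w := by
    split_ifs with h
    · simpa [gen, h] using G.gen_rel K (.vertex_idem w)
    · simpa [gen] using G.gen_rel K (.vertex_orthogonal v w h)
  s_edge e := by simpa [gen] using G.gen_rel K (.s_edge e)
  edge_r e := by simpa [gen] using G.gen_rel K (.edge_r e)
  r_ghost e := by simpa [gen] using G.gen_rel K (.r_ghost e)
  ghost_s e := by simpa [gen] using G.gen_rel K (.ghost_s e)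
  ghost_edge_self e := by simpa [gen] using G.gen_rel K (.ghost_edge e)
  ghost_edge_of_ne e f h := by simpa [gen] using G.gen_rel K (.ghost_edge_ne e f h)
  sum_edge_ghost v := by
    rw [← Finset.sum_subtype (Finset.univ.filter fun e => G.s e = v) (by simp)
      fun e => G.gen K (.edge e) * G.gen K (.ghost e)]
    simpa [gen] using G.gen_rel K (.sum_edge_ghost v (hG v))
  vtx_mem v := G.gen_mem K (.vertex v)
  edge_mem e := G.gen_mem K (.edge e)
  ghost_mem e := G.gen_mem K (.ghost e)
  vtx_ne_zero := G.gen_vertex_ne_zero K hG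
  mem_span x hx := by
    refine Submodule.span_mono ?_ hx
    rintro _ ⟨l, hl, rfl⟩
    refine ⟨l, hl, congrArg List.prod (List.map_congr_left fun g _ => ?_)⟩
    cases g <;> rfl

end DirectedGraph

theorem K0gr.le_iff {A : Type u} [Ring A] {σ : Type v} [SetLike σ A] {𝒜 : ℤ → σ} {x y : K0gr 𝒜} :
    x ≤ y ↔ y - x ∈ AddMonoidHom.mrange (K0gr.of 𝒜) := Iff.rfl

theorem corollaryh99_general {K₁ K₂ : Type*} [Field K₁] [Field K₂]
    {V₁ E₁ : Type*} [Fintype V₁] [Fintype E₁] [DecidableEq V₁]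
    {V₂ E₂ : Type*} [Fintype V₂] [Fintype E₂] [DecidableEq V₂]
    (E : DirectedGraph V₁ E₁) (F : DirectedGraph V₂ E₂) (hE : E.NoSinks) (hF : F.NoSinks) :
    Matrix.ShiftEquivalent E.adjMatrix F.adjMatrix ↔
      ∃ φ : K0gr (E.leavittGrading K₁) ≃ₗ[ℤ[T;T⁻¹]] K0gr (F.leavittGrading K₂),
        ∀ x y, φ x ≤ φ y ↔ x ≤ y := by
  have hE' := (E.leavittFamily K₁ hE).isDimensionModule
  have hF' := (F.leavittFamily K₂ hF).isDimensionModule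
  constructor
  · intro h
    obtain ⟨φ, hφ⟩ := hE'.exists_equiv_of_shiftEquivalent hF' h
    exact ⟨φ, fun x y => by rw [K0gr.le_iff, K0gr.le_iff, ← map_sub, hφ]⟩
  · rintro ⟨φ, hφ⟩
    refine hE'.shiftEquivalent_of_equiv hF' φ fun z => ?_
    have h := hφ 0 z
    rwa [map_zero, K0gr.le_iff, K0gr.le_iff, sub_zero, sub_zero] at h

theorem corollaryh99 {K : Type*} [Field K]
    {V₁ E₁ : Type*} [Fintype V₁] [Fintype E₁] [DecidableEq V₁]
    {V₂ E₂ : Type*} [Fintype V₂] [Fintype E₂] [DecidableEq V₂]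
    (E : DirectedGraph V₁ E₁) (F : DirectedGraph V₂ E₂) (hE : E.NoSinks) (hF : F.NoSinks) :
    Matrix.ShiftEquivalent E.adjMatrix F.adjMatrix ↔
      ∃ φ : K0gr (E.leavittGrading K) ≃ₗ[ℤ[T;T⁻¹]] K0gr (F.leavittGrading K),
        ∀ x y, φ x ≤ φ y ↔ x ≤ y :=
  corollaryh99_general E F hE hF
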